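/- Let $\mathrm{DD}k(\alpha)$ be the task of learning an arbitrary unknown distribution $\mathcal D$ on $[k]=\{1,\dots,k\}$: output a distribution $Q$ on $[k]$ with $d_{\mathrm{TV}}(Q,\mathcal D)=\frac12\sum_{z}|Q(z)-\mathcal D(z)|\le\alpha$. There are $n$ users; each holds $m$ samples, and all $nm$ samples are drawn independently from $\mathcal D$. A randomized algorithm $A$, with a finite output space, is $\varepsilon$-user-level DP (pure DP) if $\Pr[A(\mathbf x)\in S]\le e^{\varepsilon}\Pr[A(\mathbf x')\in S]$ for every set $S$ of outputs and all inputs $\mathbf x,\mathbf x'$ that differ only in the samples of one user. Let $n_m^{\mathrm{DD}k(\alpha)}(\varepsilon,\delta=0)$ be the smallest $n$ for which some $\varepsilon$-user-level DP algorithm, for every $\mathcal D$ on $[k]$, outputs a correct answer with probability at least $2/3$ over the samples and its own randomness. Theorem. For all sufficiently small $\alpha,\varepsilon>0$, all $k\ge 2$ and all integers $m\ge1$, $$n_m^{\mathrm{DD}k(\alpha)}(\varepsilon,\delta=0)=\tilde\Theta\left(\frac{k}{\varepsilon}+\frac{k}{\alpha\varepsilon\sqrt m}+\frac{k}{\alpha^2m}\right),$$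 where $\tilde\Theta$ suppresses factors polylogarithmic in the expression itself and in $1/\alpha$. Explicitly: there are absolute constants $\alpha_0,\varepsilon_0,C>0$ and $c\in\mathbb N$ such that for all integers $k\ge2$, $m\ge1$ and all $\alpha\in(0,\alpha_0]$, $\varepsilon\in(0,\varepsilon_0]$, writing $f=\frac{k}{\varepsilon}+\frac{k}{\alpha\varepsilon\sqrt m}+\frac{k}{\alpha^2m}$, the number $n_m^{\mathrm{DD}k(\alpha)}(\varepsilon,\delta=0)$ is finite and $$\frac{f}{C\,\log^{c}(f/\alpha)}\ \le\ n_m^{\mathrm{DD}k(\alpha)}(\varepsilon,\delta=0)\ \le\ C\,f\,\log^{c}(f/\alpha).$$ -/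

import Mathlib

open scoped BigOperators ENNReal

noncomputable section

namespace UserLevelDP

/-- The law of a tuple of independent samples, indexed by `ι`, each drawn from `P`. -/
def iid (ι : Type*) [Fintype ι] {Z : Type*} [Fintype Z] (P : PMF Z) : PMF (ι → Z) :=
  haveI : DecidableEq ι := Classical.decEq ι
  PMF.ofFintype (fun x => ∏ i, P (x i)) (by
    have h : ∑ z, P z = 1 := by rw [← tsum_fintype (L := .unconditional Z)]; exact P.tsum_coe
    have := Finset.prod_univ_sum (fun _ : ι => (Finset.univ : Finset Z)) (fun _ z => P z)
    rw [Fintype.piFinset_univ] at this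
    rw [← this]
    simp [h])

/-- The total variation distance between two distributions on a finite set. -/
def tvDist {Z : Type*} [Fintype Z] (P Q : PMF Z) : ℝ :=
  (1 / 2) * ∑ z, |(P z).toReal - (Q z).toReal|

/-- An input of `n` users with `m` samples each; `x i j` is the `j`-th sample of user `i`. -/
abbrev Input (Z : Type*) (n m : ℕ) : Type _ := Fin n → Fin m → Z

/-- Two inputs are user-level neighbors if they agree on the samples of all users but one. -/
def Neighbors {Z : Type*} {n m : ℕ} (x x' : Input Z n m) : Prop :=
  ∃ i, ∀ i', i' ≠ i → x i' = x' i'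

/-- A randomized algorithm, given by the law of its output on each input. -/
abbrev RandAlg (Z O : Type*) (n m : ℕ) : Type _ := Input Z n m → PMF O

/-- The algorithm has a finite output space. -/
def FiniteOutput {Z O : Type*} {n m : ℕ} (A : RandAlg Z O n m) : Prop :=
  ∃ S : Finset O, ∀ x, (A x).support ⊆ (S : Set O)

/-- `(ε, δ)`-user-level differential privacy. -/
def IsUserLevelDP {Z O : Type*} {n m : ℕ} (ε δ : ℝ) (A : RandAlg Z O n m) : Prop :=
  ∀ x x' : Input Z n m, Neighbors x x' → ∀ S : Set O,
    (A x).toOuterMeasure S ≤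
      ENNReal.ofReal (Real.exp ε) * (A x').toOuterMeasure S + ENNReal.ofReal δ

/-- A statistical task: the valid underlying distributions, and for each of them the set of
correct answers. -/
structure StatTask (Z O : Type*) where
  valid : Set (PMF Z)
  correct : PMF Z → Set O

/-- `A` is `γ`-useful for `T`: on `n * m` independent samples from any valid distribution, its
output is correct with probability at least `γ`, over the samples and its own randomness. -/
def IsUseful {Z O : Type*} [Fintype Z] {n m : ℕ} (T : StatTask Z O) (γ : ℝ)
    (A : RandAlg Z O n m) : Prop :=
  ∀ D ∈ T.valid,
    ENNReal.ofReal γ ≤ ((iid (Fin n) (iid (Fin m) D)).bind A).toOuterMeasure (T.correct D)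

/-- The smallest number of users of an `(ε, δ)`-user-level DP algorithm that is `γ`-useful for `T`,
with `m` samples per user; it is `⊤` if there is no such algorithm. -/
def userComplexity {Z O : Type*} [Fintype Z] (T : StatTask Z O) (m : ℕ) (ε δ γ : ℝ) : ℕ∞ :=
  ⨅ (n : ℕ) (_ : ∃ A : RandAlg Z O n m,
    FiniteOutput A ∧ IsUserLevelDP ε δ A ∧ IsUseful T γ A), (n : ℕ∞)

/-- Learning an arbitrary distribution on a domain of `k` elements up to total variation
distance `α`; the output is itself a distribution on that domain. -/
def discreteDistTask (k : ℕ) (α : ℝ) : StatTask (Fin k) (PMF (Fin k)) where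
  valid := Set.univ
  correct D := {Q | tvDist Q D ≤ α}

/-- The rate `k / ε + k / (α ε √m) + k / (α² m)`. -/
def discreteDistRate (k m : ℕ) (α ε : ℝ) : ℝ :=
  k / ε + k / (α * ε * √(m : ℝ)) + k / (α ^ 2 * m)

end UserLevelDP

end

/-! Lower bound. Take K = ⌊k/2⌋ pairs of points with masses (1 ± γ)/(2K), γ a constant multiple of
α, the order inside each pair being one bit of a hypercube vertex. An α-accurate answer decodes to a
vertex within Hamming distance K/64 of the true one. If the laws of one user's samples under any two
vertices are within t in total variation, then changing the vertex changes output probabilities by a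
factor of at most (1 + t(e^ε - 1))^n: heuristically only tn users have to change. Since balls of
radius K/64 overlap exponentially little relative to 2^K, this forces k ≲ n t ε
(`card_mul_le_of_packing`). Taking t = 1 gives k/ε; taking t ≲ α√m, from tensorization of the
Bhattacharyya coefficient, gives k/(αε√m). The term k/(α²m) is not about privacy: it is Assouad's
bound for nm samples (`tv_of_assouad`).

Upper bound. Run the exponential mechanism over a grid of (O(k/α))^k candidates. A candidate q is
scored by the largest, over sets W, of the user average of (empirical mass of W) - q(W), truncated
at τ = α + log(f/α)/√m. One user moves the score by at most 2τ/n, yet truncation hardly biases the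
mean, because a user's empirical mass fluctuates by about 1/√m. Candidates near the truth and
candidates at distance at least α then have scores a constant multiple of α apart (`score_gap`). Up
to logarithms, private selection needs n ≳ kτ/(αε), the first two terms, and uniform concentration
needs n ≳ kτ²/α², which the first and third terms cover. -/

noncomputable section

namespace UserLevelDP

section

open Finset

/-! ### Real-valued event probabilities and pure differential privacy. -/

section Privacy

variable {Z : Type*}

/-- The real-valued probability of an event. -/
def prob {O : Type*} (P : PMF O) (S : Set O) : ℝ := (P.toOuterMeasure S).toReal

lemma toOuterMeasure_le_one {O : Type*} (P : PMF O) (S : Set O) : P.toOuterMeasure S ≤ 1 := by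
  rw [PMF.toOuterMeasure_apply, ← P.tsum_coe]
  exact ENNReal.tsum_le_tsum fun a => Set.indicator_le_self _ _ _

lemma toOuterMeasure_ne_top {O : Type*} (P : PMF O) (S : Set O) : P.toOuterMeasure S ≠ ⊤ :=
  ne_top_of_le_ne_top ENNReal.one_ne_top (toOuterMeasure_le_one P S)

lemma prob_nonneg {O : Type*} (P : PMF O) (S : Set O) : 0 ≤ prob P S := ENNReal.toReal_nonneg

lemma prob_mono {O : Type*} (P : PMF O) {S T : Set O} (h : S ⊆ T) : prob P S ≤ prob P T :=
  ENNReal.toReal_mono (toOuterMeasure_ne_top P T) (MeasureTheory.measure_mono h)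

lemma prob_map {O O' : Type*} (P : PMF O) (f : O → O') (S : Set O') :
    prob (P.map f) S = prob P (f ⁻¹' S) := by
  rw [prob, PMF.toOuterMeasure_map_apply, prob]

lemma prob_coe_finset {O : Type*} (P : PMF O) (S : Finset O) :
    prob P (S : Set O) = ∑ a ∈ S, (P a).toReal := by
  rw [prob, PMF.toOuterMeasure_apply_finset, ENNReal.toReal_sum fun a _ => P.apply_ne_top a]

lemma IsUserLevelDP.prob_le {O : Type*} {n m : ℕ} {ε : ℝ} {A : RandAlg Z O n m}
    (hA : IsUserLevelDP ε 0 A) {x x' : Input Z n m} (h : Neighbors x x') (S : Set O) :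
    prob (A x) S ≤ Real.exp ε * prob (A x') S := by
  have h1 := hA x x' h S
  rw [ENNReal.ofReal_zero, add_zero] at h1
  have h2 := ENNReal.toReal_mono
    (ENNReal.mul_ne_top ENNReal.ofReal_ne_top (toOuterMeasure_ne_top _ _)) h1
  rwa [ENNReal.toReal_mul, ENNReal.toReal_ofReal (Real.exp_pos ε).le] at h2

/-- With δ = 0 the privacy inequality may be checked atom by atom and summed over the preimage; this
also includes post-processing. -/
lemma isUserLevelDP_map {O I : Type*} {n m : ℕ} {ε : ℝ} {B : RandAlg Z I n m} (f : I → O)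
    (hB : ∀ x x' : Input Z n m, Neighbors x x' → ∀ a, B x a ≤ ENNReal.ofReal (Real.exp ε) * B x' a) :
    IsUserLevelDP ε 0 fun x => (B x).map f := by
  intro x x' h S
  rw [ENNReal.ofReal_zero, add_zero, PMF.toOuterMeasure_map_apply, PMF.toOuterMeasure_map_apply,
    PMF.toOuterMeasure_apply, PMF.toOuterMeasure_apply, ← ENNReal.tsum_mul_left]
  refine ENNReal.tsum_le_tsum fun a => ?_
  by_cases ha : a ∈ f ⁻¹' S
  · simpa [Set.indicator_of_mem ha] using hB x x' h a
  · simp [Set.indicator_of_notMem ha]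

end Privacy

/-! ### Finite distributions as real weights; total variation and Bhattacharyya coefficient. -/

section Weights

variable {Z ι : Type*} [Fintype Z] [Fintype ι]

/-- The product weight of a tuple. -/
def prodW (ι : Type*) [Fintype ι] {Z : Type*} (p : Z → ℝ) (x : ι → Z) : ℝ := ∏ i, p (x i)

/-- The probability mass function with prescribed real weights. -/
def ofSimplex (w : Z → ℝ) (hw : w ∈ stdSimplex ℝ Z) : PMF Z :=
  PMF.ofFintype (fun z => ENNReal.ofReal (w z)) (by
    rw [← ENNReal.ofReal_sum_of_nonneg (fun z _ => hw.1 z), hw.2, ENNReal.ofReal_one])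

lemma ofSimplex_apply {w : Z → ℝ} (hw : w ∈ stdSimplex ℝ Z) (z : Z) :
    ofSimplex w hw z = ENNReal.ofReal (w z) := rfl

lemma toReal_ofSimplex {w : Z → ℝ} (hw : w ∈ stdSimplex ℝ Z) :
    (fun z => (ofSimplex w hw z).toReal) = w := by
  funext z
  rw [ofSimplex_apply, ENNReal.toReal_ofReal (hw.1 z)]

lemma toReal_mem_stdSimplex (P : PMF Z) : (fun z => (P z).toReal) ∈ stdSimplex ℝ Z := by
  refine ⟨fun z => ENNReal.toReal_nonneg, ?_⟩
  rw [← ENNReal.toReal_sum (fun z _ => P.apply_ne_top z),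
    ← tsum_fintype (L := .unconditional Z), P.tsum_coe, ENNReal.toReal_one]

lemma toReal_iid (P : PMF Z) (x : ι → Z) :
    (iid ι P x).toReal = prodW ι (fun z => (P z).toReal) x := by
  simp [iid, prodW, PMF.ofFintype_apply, ENNReal.toReal_prod]

lemma sum_prod_apply [DecidableEq ι] (f : ι → Z → ℝ) :
    ∑ x : ι → Z, ∏ i, f i (x i) = ∏ i, ∑ z, f i z :=
  (Fintype.prod_sum f).symm

lemma prodW_mem_stdSimplex [DecidableEq ι] {p : Z → ℝ} (hp : p ∈ stdSimplex ℝ Z) :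
    prodW ι p ∈ stdSimplex ℝ (ι → Z) := by
  refine ⟨fun x => prod_nonneg fun i _ => hp.1 _, ?_⟩
  simp only [prodW]
  rw [sum_prod_apply fun _ : ι => p]
  simp [hp.2]

lemma prob_bind_eq_sum {X O : Type*} [Fintype X] (P : PMF X) (A : X → PMF O) (S : Set O) :
    prob (P.bind A) S = ∑ x, (P x).toReal * prob (A x) S := by
  rw [prob, PMF.toOuterMeasure_bind_apply, tsum_fintype,
    ENNReal.toReal_sum fun x _ => ENNReal.mul_ne_top (P.apply_ne_top x) (toOuterMeasure_ne_top _ _)]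
  simp [prob, ENNReal.toReal_mul]

lemma isUseful_iff {O : Type*} {n m : ℕ} (T : StatTask Z O) {γ : ℝ}
    (A : RandAlg Z O n m) :
    IsUseful T γ A ↔ ∀ D ∈ T.valid, γ ≤ ∑ x : Input Z n m,
      prodW (Fin n) (prodW (Fin m) fun z => (D z).toReal) x * prob (A x) (T.correct D) := by
  refine forall₂_congr fun D _ => ?_
  rw [ENNReal.ofReal_le_iff_le_toReal (toOuterMeasure_ne_top _ _)]
  change γ ≤ prob _ _ ↔ _
  rw [prob_bind_eq_sum]
  simp only [toReal_iid]

/-- Total variation distance of two real weights. -/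
def tvW (p q : Z → ℝ) : ℝ := (1 / 2) * ∑ z, |p z - q z|

/-- The Bhattacharyya coefficient of two weights. -/
def bhatt (p q : Z → ℝ) : ℝ := ∑ z, √(p z * q z)

lemma tvW_nonneg (p q : Z → ℝ) : 0 ≤ tvW p q :=
  mul_nonneg (by norm_num) (sum_nonneg fun _ _ => abs_nonneg _)

/-- Both weights have total mass one, so `g` may be centred at the midpoint of its range at no cost;
this gains the factor 1/2 in `tvW`. -/
lemma sum_mul_sub_sum_mul_le {p q : Z → ℝ} (hp : p ∈ stdSimplex ℝ Z) (hq : q ∈ stdSimplex ℝ Z)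
    {g : Z → ℝ} {a b : ℝ} (ha : ∀ z, a ≤ g z) (hb : ∀ z, g z ≤ b) :
    ∑ z, p z * g z - ∑ z, q z * g z ≤ (b - a) * tvW p q := by
  have h1 : ∑ z, p z * g z - ∑ z, q z * g z = ∑ z, (p z - q z) * (g z - (a + b) / 2) := by
    have : ∑ z, (p z - q z) * (g z - (a + b) / 2) =
        ∑ z, p z * g z - ∑ z, q z * g z - (∑ z, p z - ∑ z, q z) * ((a + b) / 2) := by
      simp only [sub_mul, mul_sub, sum_sub_distrib, sum_mul]
    rw [this, hp.2, hq.2, sub_self, zero_mul, sub_zero]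
  rw [h1, tvW, ← mul_assoc, mul_sum]
  refine sum_le_sum fun z _ => ?_
  have h2 : |g z - (a + b) / 2| ≤ (b - a) * (1 / 2) := by
    rw [abs_le]
    constructor <;> linarith [ha z, hb z]
  calc (p z - q z) * (g z - (a + b) / 2) ≤ |(p z - q z) * (g z - (a + b) / 2)| := le_abs_self _
    _ = |g z - (a + b) / 2| * |p z - q z| := by rw [abs_mul, mul_comm]
    _ ≤ _ := mul_le_mul_of_nonneg_right h2 (abs_nonneg _)

lemma tvW_le_one {p q : Z → ℝ} (hp : p ∈ stdSimplex ℝ Z) (hq : q ∈ stdSimplex ℝ Z) :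
    tvW p q ≤ 1 := by
  have : ∑ z, |p z - q z| ≤ ∑ z, (p z + q z) := sum_le_sum fun z _ => by
    rw [abs_le]
    constructor <;> linarith [hp.1 z, hq.1 z]
  rw [sum_add_distrib, hp.2, hq.2] at this
  rw [tvW]
  linarith

/-- Cauchy–Schwarz on |p - q| = |√p - √q| (√p + √q); the two sums of squares are 2 ∓ 2 `bhatt p q`.
Unlike total variation, `bhatt` is multiplicative over independent samples, which is what yields √m
instead of m. -/
lemma sq_tvW_le {p q : Z → ℝ} (hp : p ∈ stdSimplex ℝ Z) (hq : q ∈ stdSimplex ℝ Z) :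
    tvW p q ^ 2 ≤ 1 - bhatt p q ^ 2 := by
  have h := sum_mul_sq_le_sq_mul_sq univ (fun z => |√(p z) - √(q z)|) (fun z => √(p z) + √(q z))
  have e1 : ∀ z, |√(p z) - √(q z)| * (√(p z) + √(q z)) = |p z - q z| := fun z => by
    have : p z - q z = (√(p z) - √(q z)) * (√(p z) + √(q z)) := by
      nlinarith [Real.mul_self_sqrt (hp.1 z), Real.mul_self_sqrt (hq.1 z)]
    rw [this, abs_mul, abs_of_nonneg (add_nonneg (Real.sqrt_nonneg (p z)) (Real.sqrt_nonneg _))]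
  have e2 : ∑ z, |√(p z) - √(q z)| ^ 2 = 2 - 2 * bhatt p q := by
    have : ∀ z, |√(p z) - √(q z)| ^ 2 = p z + q z - 2 * √(p z * q z) := fun z => by
      rw [sq_abs, Real.sqrt_mul (hp.1 z)]
      nlinarith [Real.mul_self_sqrt (hp.1 z), Real.mul_self_sqrt (hq.1 z)]
    simp only [this, sum_sub_distrib, sum_add_distrib, ← mul_sum, hp.2, hq.2, bhatt]
    norm_num
  have e3 : ∑ z, (√(p z) + √(q z)) ^ 2 = 2 + 2 * bhatt p q := by
    have : ∀ z, (√(p z) + √(q z)) ^ 2 = p z + q z + 2 * √(p z * q z) := fun z => by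
      rw [Real.sqrt_mul (hp.1 z)]
      nlinarith [Real.mul_self_sqrt (hp.1 z), Real.mul_self_sqrt (hq.1 z)]
    simp only [this, sum_add_distrib, ← mul_sum, hp.2, hq.2, bhatt]
    norm_num
  simp only [e1] at h
  rw [e2, e3] at h
  rw [tvW]
  nlinarith

lemma bhatt_prodW [DecidableEq ι] {p q : Z → ℝ} (hp : p ∈ stdSimplex ℝ Z) (hq : q ∈ stdSimplex ℝ Z) :
    bhatt (prodW ι p) (prodW ι q) = bhatt p q ^ Fintype.card ι := by
  have : ∀ x : ι → Z, √(prodW ι p x * prodW ι q x) = ∏ i, √(p (x i) * q (x i)) := fun x => by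
    rw [prodW, prodW, ← prod_mul_distrib, Real.sqrt_prod]
    exact fun i _ => mul_nonneg (hp.1 _) (hq.1 _)
  simp only [bhatt, this]
  rw [sum_prod_apply fun (_ : ι) z => √(p z * q z)]
  simp


end Weights

/-! ### Privacy amplification and the packing bound. -/

section Amplification

lemma prodW_cons {Y : Type*} {n : ℕ} (p : Y → ℝ) (y : Y) (x : Fin n → Y) :
    prodW (Fin (n + 1)) p (Fin.cons y x) = p y * prodW (Fin n) p x := by
  simp [prodW, Fin.prod_univ_succ]

variable {Y : Type*} [Fintype Y]

/-- The range of `g` lies in [μ, rμ] with μ its minimum, so the two means differ by at most t(r -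
1)μ, and μ is at most the mean under `p`. -/
lemma sum_mul_le_of_ratio {p q : Y → ℝ} (hp : p ∈ stdSimplex ℝ Y) (hq : q ∈ stdSimplex ℝ Y)
    {t r : ℝ} (ht : tvW q p ≤ t) (hr : 1 ≤ r) {g : Y → ℝ} (hg0 : ∀ y, 0 ≤ g y)
    (hg : ∀ y y', g y ≤ r * g y') :
    ∑ y, q y * g y ≤ (1 + t * (r - 1)) * ∑ y, p y * g y := by
  have : Nonempty Y := by
    by_contra h
    rw [not_nonempty_iff] at h
    simpa using hp.2
  obtain ⟨y₀, hy₀⟩ := Finite.exists_min g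
  have h1 := sum_mul_sub_sum_mul_le hq hp hy₀ fun z => hg z y₀
  have h2 : g y₀ ≤ ∑ y, p y * g y := by
    calc g y₀ = ∑ y, p y * g y₀ := by rw [← sum_mul, hp.2, one_mul]
      _ ≤ _ := sum_le_sum fun y _ => mul_le_mul_of_nonneg_left (hy₀ y) (hp.1 y)
  have h3 : (r * g y₀ - g y₀) * tvW q p ≤ t * (r - 1) * ∑ y, p y * g y := by
    calc (r * g y₀ - g y₀) * tvW q p = tvW q p * (r - 1) * g y₀ := by ring
      _ ≤ _ := mul_le_mul (mul_le_mul_of_nonneg_right ht (by linarith)) h2 (hg0 _)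
        (mul_nonneg ((tvW_nonneg _ _).trans ht) (by linarith))
  linarith

lemma sum_fin_succ_fun {n : ℕ} (F : (Fin (n + 1) → Y) → ℝ) :
    ∑ x, F x = ∑ y : Y, ∑ x : Fin n → Y, F (Fin.cons y x) := by
  rw [← (Fin.consEquiv fun _ : Fin (n + 1) => Y).sum_comp, Fintype.sum_prod_type]
  rfl

/-- Privacy amplification: changing the law of every user by `t` in total variation changes the
expectation of a function of bounded sensitivity ratio `r` by a factor `(1 + t (r - 1)) ^ n`. -/
lemma sum_prodW_mul_le_of_ratio {p q : Y → ℝ} (hp : p ∈ stdSimplex ℝ Y) (hq : q ∈ stdSimplex ℝ Y)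
    {t r : ℝ} (ht : tvW q p ≤ t) (hr : 1 ≤ r) {n : ℕ} {g : (Fin n → Y) → ℝ} (hg0 : ∀ x, 0 ≤ g x)
    (hg : ∀ x x' : Fin n → Y, (∃ i, ∀ i', i' ≠ i → x i' = x' i') → g x ≤ r * g x') :
    ∑ x, prodW (Fin n) q x * g x ≤ (1 + t * (r - 1)) ^ n * ∑ x, prodW (Fin n) p x * g x := by
  have hc : 0 ≤ 1 + t * (r - 1) :=
    add_nonneg zero_le_one (mul_nonneg ((tvW_nonneg _ _).trans ht) (by linarith))
  induction n with
  | zero => simp [prodW]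
  | succ n ih =>
    simp only [sum_fin_succ_fun, prodW_cons, mul_assoc, ← mul_sum]
    have h1 : ∀ y, ∑ x, prodW (Fin n) q x * g (Fin.cons y x) ≤
        (1 + t * (r - 1)) ^ n * ∑ x, prodW (Fin n) p x * g (Fin.cons y x) := fun y => by
      refine ih (fun x => hg0 _) fun x x' ⟨i, hi⟩ => hg _ _ ⟨i.succ, fun j hj => ?_⟩
      cases j using Fin.cases with
      | zero => simp
      | succ j => simpa using hi j fun h => hj (by rw [h])
    have hP : ∀ x, 0 ≤ prodW (Fin n) p x := (prodW_mem_stdSimplex hp).1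
    -- Averaging out the other users preserves the ratio bound `r` in the first user.
    have h2 := sum_mul_le_of_ratio hp hq ht hr
      (g := fun y => ∑ x, prodW (Fin n) p x * g (Fin.cons y x))
      (fun y => sum_nonneg fun x _ => mul_nonneg (hP x) (hg0 _))
      (fun y y' => by
        rw [mul_sum]
        refine sum_le_sum fun x _ => ?_
        rw [mul_left_comm]
        refine mul_le_mul_of_nonneg_left (hg _ _ ⟨0, fun j hj => ?_⟩) (hP x)
        cases j using Fin.cases with
        | zero => exact absurd rfl hj
        | succ j => simp)
    calc _ ≤ ∑ y, q y * ((1 + t * (r - 1)) ^ n * ∑ x, prodW (Fin n) p x * g (Fin.cons y x)) :=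
          sum_le_sum fun y _ => mul_le_mul_of_nonneg_left (h1 y) (hq.1 y)
      _ = (1 + t * (r - 1)) ^ n * ∑ y, q y * ∑ x, prodW (Fin n) p x * g (Fin.cons y x) := by
          rw [mul_sum]
          exact sum_congr rfl fun y _ => by ring
      _ ≤ (1 + t * (r - 1)) ^ n *
          ((1 + t * (r - 1)) * ∑ y, p y * ∑ x, prodW (Fin n) p x * g (Fin.cons y x)) :=
          mul_le_mul_of_nonneg_left h2 (pow_nonneg hc n)
      _ = _ := by rw [pow_succ, mul_assoc]

/-- Packing lower bound for pure differential privacy, in terms of the overlap of the balls. -/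
lemma card_mul_le_of_packing {V W : Type*} [Fintype V] [Nonempty V] [Fintype W]
    [DecidableEq W]
    {p : V → Y → ℝ} (hp : ∀ v, p v ∈ stdSimplex ℝ Y) {t r : ℝ} (hr : 1 ≤ r)
    (ht : ∀ u v, tvW (p v) (p u) ≤ t) {n : ℕ} {G : (Fin n → Y) → PMF W}
    (hG : ∀ x x' : Fin n → Y, (∃ i, ∀ i', i' ≠ i → x i' = x' i') →
      ∀ S, prob (G x) S ≤ r * prob (G x') S)
    {B : V → Finset W} {M s : ℝ}
    (hM : ∀ w, ((univ.filter fun v => w ∈ B v).card : ℝ) ≤ M)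
    (hs : ∀ v, s ≤ ∑ x, prodW (Fin n) (p v) x * prob (G x) (B v)) :
    Fintype.card V * s ≤ (1 + t * (r - 1)) ^ n * M := by
  obtain ⟨u⟩ := ‹Nonempty V›
  have hc : 0 ≤ 1 + t * (r - 1) :=
    add_nonneg zero_le_one (mul_nonneg ((tvW_nonneg _ _).trans (ht u u)) (by linarith))
  have hP := prodW_mem_stdSimplex (ι := Fin n) (hp u)
  -- For a fixed input, each output is counted by at most `M` of the sets `B v`. Every vertex is
  -- then compared with the single reference `u`.
  have hov : ∀ x, ∑ v, prob (G x) (B v) ≤ M := fun x => by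
    have hw := toReal_mem_stdSimplex (G x)
    calc ∑ v, prob (G x) (B v) = ∑ v, ∑ w, if w ∈ B v then (G x w).toReal else 0 :=
          sum_congr rfl fun v _ => by rw [prob_coe_finset, sum_ite_mem, univ_inter]
      _ = ∑ w, (G x w).toReal * ((univ.filter fun v => w ∈ B v).card : ℝ) := by
          rw [sum_comm]
          refine sum_congr rfl fun w _ => ?_
          rw [← sum_filter, sum_const, nsmul_eq_mul, mul_comm]
      _ ≤ ∑ w, (G x w).toReal * M :=
          sum_le_sum fun w _ => mul_le_mul_of_nonneg_left (hM w) (hw.1 w)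
      _ = M := by rw [← sum_mul, hw.2, one_mul]
  calc Fintype.card V * s = ∑ _v : V, s := by simp
    _ ≤ ∑ v, (1 + t * (r - 1)) ^ n * ∑ x, prodW (Fin n) (p u) x * prob (G x) (B v) :=
        sum_le_sum fun v _ => (hs v).trans <|
          sum_prodW_mul_le_of_ratio (hp u) (hp v) (ht u v) hr (fun x => prob_nonneg _ _)
            fun x x' h => hG x x' h _
    _ = (1 + t * (r - 1)) ^ n * ∑ x, prodW (Fin n) (p u) x * ∑ v, prob (G x) (B v) := by
        rw [← mul_sum, sum_comm]
        simp only [mul_sum]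
    _ ≤ (1 + t * (r - 1)) ^ n * ∑ x, prodW (Fin n) (p u) x * M :=
        mul_le_mul_of_nonneg_left
          (sum_le_sum fun x _ => mul_le_mul_of_nonneg_left (hov x) (hP.1 x)) (pow_nonneg hc n)
    _ = _ := by rw [← sum_mul, hP.2, one_mul]

end Amplification

/-! ### Hamming balls and Assouad's lemma. -/

section Hypercube

variable {K : ℕ}

lemma sum_pow_hammingDist (w : Fin K → Bool) (a : ℝ) :
    ∑ v, a ^ hammingDist w v = (1 + a) ^ K := by
  have h : ∀ v : Fin K → Bool, a ^ hammingDist w v = ∏ i, if w i ≠ v i then a else 1 := fun v => by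
    rw [prod_ite, prod_const, prod_const_one, mul_one, hammingDist]
  simp only [h]
  rw [sum_prod_apply fun i b => if w i ≠ b then a else 1]
  have h2 : ∀ i, ∑ b, (if w i ≠ b then a else 1) = 1 + a := fun i => by
    cases w i <;> simp [add_comm]
  simp only [h2, prod_const, card_univ, Fintype.card_fin]

/-- The Hamming ball of radius `K / 64`. -/
def smallBall (v : Fin K → Bool) : Finset (Fin K → Bool) :=
  univ.filter fun w => 64 * hammingDist w v ≤ K

/-- A Chernoff bound: weight vertices by a power of the Hamming distance that is at least one on the
ball. The base 10/9 leaves 2 · (9/10) = 9/5 per coordinate for the packing argument. -/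
lemma card_smallBall_le (w : Fin K → Bool) :
    ((univ.filter fun v => w ∈ smallBall v).card : ℝ) ≤ (10 / 9) ^ K := by
  have h1 : ∀ v ∈ univ.filter (fun v => w ∈ smallBall v),
      (1 : ℝ) ≤ (11 / 10) ^ K * ((10 / 11) ^ 64) ^ hammingDist w v := fun v hv => by
    have hv' : 64 * hammingDist w v ≤ K := by simpa [smallBall] using hv
    rw [← pow_mul]
    calc (1 : ℝ) = (11 / 10) ^ K * (10 / 11) ^ K := by rw [← mul_pow]; norm_num
      _ ≤ _ := mul_le_mul_of_nonneg_left
        (pow_le_pow_of_le_one (by norm_num) (by norm_num) hv') (by positivity)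
  calc ((univ.filter fun v => w ∈ smallBall v).card : ℝ)
      = ∑ v ∈ univ.filter (fun v => w ∈ smallBall v), (1 : ℝ) := by simp
    _ ≤ ∑ v ∈ univ.filter (fun v => w ∈ smallBall v),
        (11 / 10 : ℝ) ^ K * ((10 / 11) ^ 64) ^ hammingDist w v := sum_le_sum h1
    _ ≤ ∑ v, (11 / 10 : ℝ) ^ K * ((10 / 11) ^ 64) ^ hammingDist w v :=
        sum_le_univ_sum_of_nonneg fun v => by positivity
    _ = (11 / 10 * (1 + (10 / 11) ^ 64)) ^ K := by
        rw [← mul_sum, sum_pow_hammingDist, mul_pow]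
    _ ≤ _ := pow_le_pow_left₀ (by positivity) (by norm_num) K

/-- Flip one coordinate of a vertex of the hypercube. -/
def flip (i : Fin K) (v : Fin K → Bool) : Fin K → Bool := Function.update v i (!v i)

lemma flip_involutive (i : Fin K) : Function.Involutive (flip i) := fun v => by
  simp [flip]

lemma hammingDist_flip (i : Fin K) (v : Fin K → Bool) : hammingDist v (flip i v) = 1 := by
  rw [hammingDist, card_eq_one]
  refine ⟨i, ?_⟩
  ext j
  rw [mem_filter_univ, mem_singleton]
  by_cases h : j = i
  · subst h
    simp [flip]
  · simp [flip, h]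

/-- Assouad's lemma on the hypercube, for estimators that hit small Hamming balls. -/
lemma tv_of_assouad {X : Type*} [Fintype X] (hK : 0 < K) {P : (Fin K → Bool) → X → ℝ}
    (hP : ∀ v, P v ∈ stdSimplex ℝ X) {T : ℝ} (hT : ∀ i v, tvW (P v) (P (flip i v)) ≤ T)
    {G : X → PMF (Fin K → Bool)}
    (hs : ∀ v, 2 / 3 ≤ ∑ x, P v x * prob (G x) (smallBall v)) : 3 / 10 ≤ T := by
  have hw := fun x => toReal_mem_stdSimplex (G x)
  let err : Fin K → (Fin K → Bool) → ℝ := fun i v =>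
    ∑ x, P v x * ∑ w, if w i ≠ v i then (G x w).toReal else 0
  -- At most K/64 coordinates are wrong inside the ball and at most K outside it, which has
  -- probability at most 1/3; 67/192 = 1 + 1/64 - 2/3.
  have herr : ∀ v, ∑ i, err i v ≤ K * (67 / 192) := fun v => by
    have h1 : ∀ x, ∑ i, ∑ w, (if w i ≠ v i then (G x w).toReal else 0) ≤
        K * (1 - prob (G x) (smallBall v)) + K / 64 := fun x => by
      have h2 : ∀ w, (hammingDist w v : ℝ) ≤
          K * (1 - if w ∈ smallBall v then 1 else 0) + K / 64 := fun w => by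
        split_ifs with h
        · have : 64 * hammingDist w v ≤ K := by simpa [smallBall] using h
          have : (64 : ℝ) * hammingDist w v ≤ K := by exact_mod_cast this
          linarith
        · have : hammingDist w v ≤ K := by simpa using hammingDist_le_card_fintype (x := w) (y := v)
          have : (hammingDist w v : ℝ) ≤ K := by exact_mod_cast this
          have : (0 : ℝ) ≤ K := by positivity
          linarith
      calc ∑ i, ∑ w, (if w i ≠ v i then (G x w).toReal else 0)
          = ∑ w, (G x w).toReal * hammingDist w v := by
            rw [sum_comm]
            refine sum_congr rfl fun w _ => ?_
            rw [← sum_filter, sum_const, nsmul_eq_mul, mul_comm, hammingDist]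
        _ ≤ ∑ w, (G x w).toReal * (K * (1 - if w ∈ smallBall v then 1 else 0) + K / 64) :=
            sum_le_sum fun w _ => mul_le_mul_of_nonneg_left (h2 w) ((hw x).1 w)
        _ = ∑ w, ((G x w).toReal * (K + K / 64) -
              K * if w ∈ smallBall v then (G x w).toReal else 0) :=
            sum_congr rfl fun w _ => by split_ifs <;> ring
        _ = _ := by
            rw [sum_sub_distrib, ← sum_mul, (hw x).2, ← mul_sum, sum_ite_mem, univ_inter,
              prob_coe_finset]
            ring
    calc ∑ i, err i v = ∑ x, P v x * ∑ i, ∑ w, (if w i ≠ v i then (G x w).toReal else 0) := by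
          simp only [err]
          rw [sum_comm]
          simp only [mul_sum]
      _ ≤ ∑ x, P v x * (K * (1 - prob (G x) (smallBall v)) + K / 64) :=
          sum_le_sum fun x _ => mul_le_mul_of_nonneg_left (h1 x) ((hP v).1 x)
      _ = (∑ x, P v x) * (K + K / 64) - K * ∑ x, P v x * prob (G x) (smallBall v) := by
          rw [sum_mul, mul_sum, ← sum_sub_distrib]
          exact sum_congr rfl fun x _ => by ring
      _ ≤ (K + K / 64) - K * (2 / 3) := by
          rw [(hP v).2, one_mul]
          exact sub_le_sub_left (mul_le_mul_of_nonneg_left (hs v) (by positivity)) _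
      _ = _ := by ring
  -- Two-point testing: guessing bit `i` distinguishes `v` from its flip, so the two error
  -- probabilities sum to at least one minus the total variation.
  have hpair : ∀ i v, 1 - T ≤ err i v + err i (flip i v) := fun i v => by
    let a : X → ℝ := fun x => ∑ w, if w i = v i then (G x w).toReal else 0
    have h1 : err i v = 1 - ∑ x, P v x * a x := by
      have : ∀ x, (∑ w, if w i ≠ v i then (G x w).toReal else 0) = 1 - a x := fun x => by
        rw [← (hw x).2, ← sum_sub_distrib]
        exact sum_congr rfl fun w _ => by split_ifs <;> simp_all
      simp only [err, this, mul_sub, sum_sub_distrib, mul_one, (hP v).2]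
    have h2 : err i (flip i v) = ∑ x, P (flip i v) x * a x := by
      have : ∀ w : Fin K → Bool, w i ≠ flip i v i ↔ w i = v i := fun w => by
        simp [flip]
      simp only [err, this, a]
    have h3 := sum_mul_sub_sum_mul_le (hP v) (hP (flip i v)) (g := a) (a := 0) (b := 1)
      (fun x => sum_nonneg fun w _ => by split_ifs <;> simp)
      (fun x => by
        rw [← (hw x).2]
        exact sum_le_sum fun w _ => by split_ifs <;> simp)
    have := hT i v
    linarith
  have hV : (0 : ℝ) < Fintype.card (Fin K → Bool) := by exact_mod_cast Fintype.card_pos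
  have h1 : (Fintype.card (Fin K → Bool)) * (K * (1 - T)) ≤
      2 * (Fintype.card (Fin K → Bool) * (K * (67 / 192))) := by
    calc (Fintype.card (Fin K → Bool)) * (K * (1 - T))
        = ∑ i : Fin K, ∑ v : Fin K → Bool, (1 - T) := by simp; ring
      _ ≤ ∑ i : Fin K, ∑ v : Fin K → Bool, (err i v + err i (flip i v)) :=
          sum_le_sum fun i _ => sum_le_sum fun v _ => hpair i v
      _ = ∑ i : Fin K, 2 * ∑ v : Fin K → Bool, err i v := by
          refine sum_congr rfl fun i _ => ?_
          rw [sum_add_distrib, two_mul]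
          congr 1
          exact Equiv.sum_comp (flip_involutive i).toPerm (err i)
      _ = 2 * ∑ v : Fin K → Bool, ∑ i : Fin K, err i v := by rw [← mul_sum, sum_comm]
      _ ≤ 2 * ∑ v : Fin K → Bool, (K * (67 / 192) : ℝ) :=
          mul_le_mul_of_nonneg_left (sum_le_sum fun v _ => herr v) (by norm_num)
      _ = _ := by simp
  have hK' : (0 : ℝ) < K := by exact_mod_cast hK
  have h2 : (1 - T) ≤ 67 / 96 := by
    by_contra hc
    have : 0 < Fintype.card (Fin K → Bool) * (K * ((1 - T) - 67 / 96)) :=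
      mul_pos hV (mul_pos hK' (by linarith))
    nlinarith
  linarith

end Hypercube

/-! ### The paired hard distributions and their decoding. -/

section HardFamily

variable {K k : ℕ} (e : Fin K × Bool ↪ Fin k) (γ : ℝ)

/-- The hard distribution of a vertex of the hypercube: `2 K` points come in `K` pairs, and the
two points of a pair have masses `(1 ± γ) / (2 K)` in an order given by the vertex. -/
def hardW (v : Fin K → Bool) : Fin k → ℝ :=
  Function.extend e (fun y => (1 + if v y.1 = y.2 then γ else -γ) / (2 * K)) 0

lemma hardW_apply (v : Fin K → Bool) (y : Fin K × Bool) :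
    hardW e γ v (e y) = (1 + if v y.1 = y.2 then γ else -γ) / (2 * K) :=
  e.injective.extend_apply _ _ _

lemma hardW_nonneg (h0 : 0 ≤ γ) (h1 : γ ≤ 1) (v : Fin K → Bool) (z : Fin k) :
    0 ≤ hardW e γ v z := by
  by_cases h : ∃ y, e y = z
  · obtain ⟨y, rfl⟩ := h
    rw [hardW_apply]
    refine div_nonneg ?_ (by positivity)
    split_ifs <;> linarith
  · rw [hardW, Function.extend_apply' _ _ _ h]
    rfl

lemma hardW_mem_stdSimplex (hK : 0 < K) (h0 : 0 ≤ γ) (h1 : γ ≤ 1) (v : Fin K → Bool) :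
    hardW e γ v ∈ stdSimplex ℝ (Fin k) := by
  refine ⟨hardW_nonneg e γ h0 h1 v, ?_⟩
  have hK' : (0 : ℝ) < K := by exact_mod_cast hK
  rw [← Fintype.sum_of_injective e e.injective (fun y => hardW e γ v (e y)) (hardW e γ v)
    (fun z hz => by
      rw [hardW, Function.extend_apply']
      · rfl
      · simpa using hz) (fun _ => rfl)]
  simp only [hardW_apply, Fintype.sum_prod_type]
  have : ∀ i, ∑ b, (1 + if v i = b then γ else -γ) / (2 * (K : ℝ)) = 1 / K := fun i => by
    cases v i <;> simp <;> field_simp <;> ring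
  simp only [this]
  simp [hK'.ne']

lemma sum_le_sum_of_embedding {F : Fin k → ℝ} (hF : ∀ z, 0 ≤ F z) :
    ∑ i, ∑ b, F (e (i, b)) ≤ ∑ z, F z := by
  rw [← Fintype.sum_prod_type fun y => F (e y), ← sum_map univ e F]
  exact sum_le_univ_sum_of_nonneg hF

/-- A pair on which the vertices agree contributes 1/K, any other pair √(1 - γ²)/K ≥ (1 - γ²)/K. -/
lemma le_bhatt_hardW (hK : 0 < K) (h0 : 0 ≤ γ) (h1 : γ ≤ 1) (u v : Fin K → Bool) :
    1 - γ ^ 2 * hammingDist u v / K ≤ bhatt (hardW e γ u) (hardW e γ v) := by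
  have hK' : (0 : ℝ) < K := by exact_mod_cast hK
  refine le_trans ?_ (sum_le_sum_of_embedding e fun z => Real.sqrt_nonneg _)
  have hpair : ∀ i, (1 - γ ^ 2 * if u i ≠ v i then 1 else 0) / K ≤
      ∑ b, √(hardW e γ u (e (i, b)) * hardW e γ v (e (i, b))) := fun i => by
    have hd : ∀ x y : ℝ, x / (2 * K) * (y / (2 * K)) = x * y / (2 * K) ^ 2 := fun x y => by
      field_simp
    have hs : (1 - γ ^ 2) ≤ √(1 - γ ^ 2) := by
      refine Real.le_sqrt_of_sq_le ?_
      have hγ : γ ^ 2 ≤ 1 := pow_le_one₀ h0 h1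
      nlinarith [mul_nonneg (sq_nonneg γ) (sub_nonneg.2 hγ)]
    have a1 : √((1 + γ) * (1 + γ)) = 1 + γ := Real.sqrt_mul_self (by linarith)
    have a2 : √((1 + -γ) * (1 + -γ)) = 1 + -γ := Real.sqrt_mul_self (by linarith)
    have a3 : (1 + γ) * (1 + -γ) = 1 - γ ^ 2 := by ring
    have a4 : (1 + -γ) * (1 + γ) = 1 - γ ^ 2 := by ring
    simp only [hardW_apply, hd, Real.sqrt_div' _ (sq_nonneg (2 * (K : ℝ))),
      Real.sqrt_sq (by positivity : (0 : ℝ) ≤ 2 * K), Fintype.sum_bool]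
    rw [← add_div, div_le_div_iff₀ hK' (by positivity)]
    cases u i <;> cases v i <;> simp [a1, a2, a3, a4] <;> nlinarith
  refine le_trans (le_of_eq ?_) (sum_le_sum fun i _ => hpair i)
  rw [← sum_div, sum_sub_distrib, ← mul_sum, sum_boole]
  simp only [sum_const, card_univ, Fintype.card_fin, nsmul_eq_mul, mul_one, hammingDist]
  field_simp

/-- Read off a vertex of the hypercube from a distribution. -/
def decode (Q : Fin k → ℝ) (i : Fin K) : Bool := decide (Q (e (i, false)) ≤ Q (e (i, true)))

/-- A wrongly decoded bit means `Q` orders the pair against a true gap of γ/K (possibly as a tie),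
so the two errors on that pair total at least γ/K. -/
lemma hammingDist_decode_le (hK : 0 < K) (Q : Fin k → ℝ) (v : Fin K → Bool) :
    hammingDist (decode e Q) v * (γ / K) ≤ ∑ z, |Q z - hardW e γ v z| := by
  have hK' : (0 : ℝ) < K := by exact_mod_cast hK
  refine le_trans ?_ (sum_le_sum_of_embedding e fun z => abs_nonneg _)
  rw [hammingDist, ← nsmul_eq_mul, ← sum_const, sum_filter]
  refine sum_le_sum fun i _ => ?_
  simp only [hardW_apply, Fintype.sum_bool]
  have h1 : γ / K = (1 + γ) / (2 * K) - (1 + -γ) / (2 * K) := by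
    field_simp
    ring
  have t1 := neg_abs_le (Q (e (i, true)) - (1 + if v i = true then γ else -γ) / (2 * K))
  have t2 := neg_abs_le (Q (e (i, false)) - (1 + if v i = false then γ else -γ) / (2 * K))
  have t3 := le_abs_self (Q (e (i, true)) - (1 + if v i = true then γ else -γ) / (2 * K))
  have t4 := le_abs_self (Q (e (i, false)) - (1 + if v i = false then γ else -γ) / (2 * K))
  by_cases h : decode e Q i ≠ v i
  · rw [if_pos h]
    by_cases hq : Q (e (i, false)) ≤ Q (e (i, true))
    · have hv : v i = false := by simpa [decode, hq] using h
      simp only [hv, Bool.false_eq_true, if_true, if_false] at t1 t2 t3 t4 ⊢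
      linarith
    · have hv : v i = true := by simpa [decode, hq] using h
      push Not at hq
      simp only [hv, Bool.true_eq_false, if_true, if_false] at t1 t2 t3 t4 ⊢
      linarith
  · rw [if_neg h]
    positivity

end HardFamily

/-! ### The three lower bounds. -/

section LowerBound

/-- Bernoulli's inequality together with 1 - x² ≤ 2(1 - x). -/
lemma one_sub_sq_pow_le {b c : ℝ} (hc1 : c ≤ 1) (hb : 1 - c ≤ b) (N : ℕ) :
    1 - (b ^ N) ^ 2 ≤ 2 * (N * c) := by
  have h1 : 1 + (N : ℝ) * (-c) ≤ (1 + -c) ^ N := one_add_mul_le_pow (by linarith) N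
  have h2 : (1 + -c) ^ N ≤ b ^ N := pow_le_pow_left₀ (by linarith) (by linarith) N
  nlinarith [sq_nonneg (b ^ N - 1)]

theorem rate_le_of_isUseful {k m n : ℕ} (hk : 2 ≤ k) (hm : 1 ≤ m) {α ε : ℝ} (hα : 0 < α)
    (hα' : α ≤ 1 / 256) (hε : 0 < ε) (hε' : ε ≤ 1) {A : RandAlg (Fin k) (PMF (Fin k)) n m}
    (hA : IsUserLevelDP ε 0 A) (hU : IsUseful (discreteDistTask k α) (2 / 3) A) :
    discreteDistRate k m α ε ≤ 2000000 * n := by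
  obtain ⟨K, hK⟩ : ∃ K, K = k / 2 := ⟨_, rfl⟩
  have hK0 : 0 < K := by omega
  have hkK : (k : ℝ) ≤ 3 * K := by exact_mod_cast (by omega : k ≤ 3 * K)
  have hKR : (1 : ℝ) ≤ K := by exact_mod_cast hK0
  have hmR : (1 : ℝ) ≤ m := by exact_mod_cast hm
  obtain ⟨e⟩ : Nonempty (Fin K × Bool ↪ Fin k) :=
    Function.Embedding.nonempty_of_card_le (by simp; omega)
  -- Total variation α is ℓ¹ distance 2α = γ/64, that is, at most K/64 decoding errors.
  obtain ⟨γ, hγ⟩ : ∃ γ, γ = 128 * α := ⟨_, rfl⟩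
  have hγ0 : 0 < γ := by linarith
  have hγ1 : γ ≤ 1 / 2 := by linarith
  have hD := fun v => hardW_mem_stdSimplex e γ hK0 hγ0.le (by linarith) v
  let D : (Fin K → Bool) → Fin k → ℝ := hardW e γ
  let G : Input (Fin k) n m → PMF (Fin K → Bool) := fun x =>
    (A x).map fun Q => decode e fun z => (Q z).toReal
  have hDm := fun v => prodW_mem_stdSimplex (ι := Fin m) (hD v)
  have hDn := fun v => prodW_mem_stdSimplex (ι := Fin n) (hDm v)
  have hs : ∀ v, 2 / 3 ≤ ∑ x, prodW (Fin n) (prodW (Fin m) (D v)) x * prob (G x) (smallBall v) := by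
    intro v
    have h1 := (isUseful_iff _ A).1 hU (ofSimplex (D v) (hD v)) (Set.mem_univ _)
    rw [toReal_ofSimplex] at h1
    refine h1.trans (sum_le_sum fun x _ => mul_le_mul_of_nonneg_left ?_ ((hDn v).1 x))
    rw [prob_map]
    refine prob_mono _ fun Q hQ => ?_
    have hQ' : tvDist Q (ofSimplex (D v) (hD v)) ≤ α := hQ
    have h2 := hammingDist_decode_le e γ hK0 (fun z => (Q z).toReal) v
    have h3 : ∀ z, (ofSimplex (D v) (hD v) z).toReal = hardW e γ v z :=
      congr_fun (toReal_ofSimplex (hD v))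
    simp only [tvDist, h3] at hQ'
    simp only [Set.mem_preimage, mem_coe, smallBall, mem_filter_univ]
    have h4 : (hammingDist (decode e fun z => (Q z).toReal) v : ℝ) * (γ / K) ≤ γ / 64 := by
      linarith
    rw [mul_div_assoc', div_le_iff₀ (by linarith)] at h4
    have h5 : (64 : ℝ) * hammingDist (decode e fun z => (Q z).toReal) v ≤ K := by
      by_contra hc
      push Not at hc
      nlinarith
    exact_mod_cast h5
  have hexp : Real.exp ε - 1 ≤ 2 * ε := by
    have := Real.abs_exp_sub_one_le (x := ε) (by rwa [abs_of_pos hε])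
    rw [abs_of_pos hε] at this
    exact (le_abs_self _).trans this
  have hexp1 : 1 ≤ Real.exp ε := Real.one_le_exp hε.le
  have pack : ∀ t, (∀ u v, tvW (prodW (Fin m) (D v)) (prodW (Fin m) (D u)) ≤ t) →
      (k : ℝ) ≤ 36 * (n * (t * ε)) := by
    intro t ht
    have ht0 : 0 ≤ t := (tvW_nonneg _ _).trans (ht (fun _ => true) fun _ => true)
    have h1 := card_mul_le_of_packing hDm hexp1 ht (fun x x' h S => by
      simp only [G, prob_map]
      exact hA.prob_le h _) card_smallBall_le hs
    have h2 : (6 / 5 : ℝ) ^ K ≤ (1 + t * (Real.exp ε - 1)) ^ n := by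
      have h3 : ((Fintype.card (Fin K → Bool) : ℕ) : ℝ) = 2 ^ K := by simp
      rw [h3] at h1
      -- The success probability is absorbed into the exponential, leaving 2 · (2/3) · (9/10) = 6/5
      -- per coordinate.
      have h4 : (2 / 3 : ℝ) ^ K ≤ 2 / 3 := pow_le_of_le_one (by norm_num) (by norm_num) hK0.ne'
      have h5 : (6 / 5 : ℝ) ^ K * (10 / 9) ^ K = 2 ^ K * (2 / 3) ^ K := by
        rw [← mul_pow, ← mul_pow]
        norm_num
      refine le_of_mul_le_mul_right ?_ (by positivity : (0 : ℝ) < (10 / 9) ^ K)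
      rw [h5]
      exact (mul_le_mul_of_nonneg_left h4 (by positivity)).trans h1
    have h3 : (1 + t * (Real.exp ε - 1)) ^ n ≤ Real.exp (n * (t * (2 * ε))) := by
      rw [Real.exp_nat_mul]
      refine pow_le_pow_left₀ (add_nonneg zero_le_one (mul_nonneg ht0 (by linarith))) ?_ n
      rw [add_comm]
      exact (Real.add_one_le_exp _).trans
        (Real.exp_le_exp.2 (mul_le_mul_of_nonneg_left hexp ht0))
    have h4 := Real.log_le_log (by positivity) (h2.trans h3)
    rw [Real.log_exp, Real.log_pow] at h4
    have h5 := Real.one_sub_inv_le_log_of_pos (by norm_num : (0 : ℝ) < 6 / 5)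
    have h6 : (K : ℝ) * (1 / 6) ≤ K * Real.log (6 / 5) :=
      mul_le_mul_of_nonneg_left (by norm_num at h5 ⊢; exact h5) (by positivity)
    linarith
  have hb : ∀ u v, 1 - γ ^ 2 ≤ bhatt (D u) (D v) := fun u v => by
    refine le_trans ?_ (le_bhatt_hardW e γ hK0 hγ0.le (by linarith) u v)
    have : (hammingDist u v : ℝ) ≤ K := by
      exact_mod_cast (by simpa using hammingDist_le_card_fintype (x := u) (y := v))
    have : γ ^ 2 * hammingDist u v / K ≤ γ ^ 2 := by
      rw [div_le_iff₀ (by linarith)]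
      exact mul_le_mul_of_nonneg_left this (sq_nonneg γ)
    linarith
  have b1 := pack 1 fun u v => tvW_le_one (hDm v) (hDm u)
  have b2 := pack (√(2 * (m * γ ^ 2))) fun u v => by
    refine Real.le_sqrt_of_sq_le ((sq_tvW_le (hDm v) (hDm u)).trans ?_)
    rw [bhatt_prodW (hD v) (hD u), Fintype.card_fin]
    exact one_sub_sq_pow_le (by nlinarith) (hb v u) m
  -- Flipping one bit changes a single pair, hence γ²/K in place of the γ² of `hb`.
  have b3 : 3 / 10 ≤ √(2 * ((m * n : ℕ) * (γ ^ 2 / K))) := by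
    refine tv_of_assouad hK0 hDn (fun i v => ?_) hs
    refine Real.le_sqrt_of_sq_le ((sq_tvW_le (hDn v) (hDn _)).trans ?_)
    rw [bhatt_prodW (hDm v) (hDm _), bhatt_prodW (hD v) (hD _), Fintype.card_fin, Fintype.card_fin,
      ← pow_mul (bhatt (D v) _)]
    refine one_sub_sq_pow_le ?_ ?_ _
    · rw [div_le_one (by linarith)]
      nlinarith
    · have := le_bhatt_hardW e γ hK0 hγ0.le (by linarith) v (flip i v)
      rw [hammingDist_flip, Nat.cast_one, mul_one] at this
      exact this
  have c1 : k / ε ≤ 36 * n := by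
    rw [div_le_iff₀ hε]
    linarith
  have hsm : 0 < √(m : ℝ) := Real.sqrt_pos.2 (by linarith)
  have c2 : k / (α * ε * √(m : ℝ)) ≤ 9216 * n := by
    rw [div_le_iff₀ (by positivity)]
    have h1 : √(2 * (m * γ ^ 2)) ≤ 256 * (α * √(m : ℝ)) := by
      rw [Real.sqrt_le_left (by positivity), hγ, mul_pow, mul_pow, mul_pow,
        Real.sq_sqrt (by linarith)]
      nlinarith [mul_nonneg (by linarith : (0 : ℝ) ≤ m) (sq_nonneg α)]
    calc (k : ℝ) ≤ 36 * (n * (√(2 * (m * γ ^ 2)) * ε)) := b2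
      _ ≤ 36 * (n * (256 * (α * √(m : ℝ)) * ε)) := by gcongr
      _ = _ := by ring
  have c3 : k / (α ^ 2 * m) ≤ 1100000 * n := by
    rw [div_le_iff₀ (by positivity)]
    rw [Real.le_sqrt' (by norm_num)] at b3
    have h1 : (2 : ℝ) * ((m * n : ℕ) * (γ ^ 2 / K)) = 2 * (m * n * γ ^ 2) / K := by
      push_cast
      ring
    rw [h1, le_div_iff₀ (by linarith), hγ] at b3
    nlinarith [mul_nonneg (mul_nonneg (by linarith : (0 : ℝ) ≤ m) (Nat.cast_nonneg n : (0 : ℝ) ≤ n))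
      (sq_nonneg α)]
  have hn : (0 : ℝ) ≤ n := Nat.cast_nonneg n
  rw [discreteDistRate]
  linarith

end LowerBound

/-! ### Hoeffding's inequality for finite product weights. -/

section Concentration

variable {Y ι : Type*} [Fintype Y] [Fintype ι] [DecidableEq ι]

/-- Bound the exponential by its chord on [-b, b]; the linear part averages to zero and leaves
cosh(tb). -/
lemma mgf_le {p : Y → ℝ} (hp : p ∈ stdSimplex ℝ Y) {f : Y → ℝ} {b : ℝ} (hb : 0 < b)
    (hf : ∀ y, |f y| ≤ b) (h0 : ∑ y, p y * f y = 0) (t : ℝ) :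
    ∑ y, p y * Real.exp (t * f y) ≤ Real.exp ((t * b) ^ 2 / 2) := by
  calc ∑ y, p y * Real.exp (t * f y)
      ≤ ∑ y, p y * (Real.cosh (t * b) + f y / b * Real.sinh (t * b)) := by
        refine sum_le_sum fun y _ => mul_le_mul_of_nonneg_left ?_ (hp.1 y)
        have h := Real.exp_mul_le_cosh_add_mul_sinh (t := f y / b)
          (by rw [abs_div, abs_of_pos hb]; exact (div_le_one hb).2 (hf y)) (t * b)
        rwa [show f y / b * (t * b) = t * f y by field_simp] at h
    _ = (∑ y, p y) * Real.cosh (t * b) + (∑ y, p y * f y) * (Real.sinh (t * b) / b) := by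
        rw [sum_mul, sum_mul, ← sum_add_distrib]
        exact sum_congr rfl fun y _ => by ring
    _ = Real.cosh (t * b) := by rw [hp.2, h0, one_mul, zero_mul, add_zero]
    _ ≤ _ := Real.cosh_le_exp_half_sq _

lemma mgf_prodW_le {p : Y → ℝ} (hp : p ∈ stdSimplex ℝ Y) {f : Y → ℝ} {b : ℝ} (hb : 0 < b)
    (hf : ∀ y, |f y| ≤ b) (h0 : ∑ y, p y * f y = 0) (t : ℝ) :
    ∑ x : ι → Y, prodW ι p x * Real.exp (t * ∑ i, f (x i)) ≤
      Real.exp (Fintype.card ι * ((t * b) ^ 2 / 2)) := by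
  have h1 : ∀ x : ι → Y, prodW ι p x * Real.exp (t * ∑ i, f (x i)) =
      ∏ i, p (x i) * Real.exp (t * f (x i)) := fun x => by
    rw [prodW, mul_sum, Real.exp_sum, ← prod_mul_distrib]
  simp only [h1]
  rw [sum_prod_apply fun (_ : ι) y => p y * Real.exp (t * f y), prod_const, card_univ,
    Real.exp_nat_mul]
  exact pow_le_pow_left₀
    (sum_nonneg fun y _ => mul_nonneg (hp.1 y) (Real.exp_pos _).le) (mgf_le hp hb hf h0 t) _

lemma hoeffding {p : Y → ℝ} (hp : p ∈ stdSimplex ℝ Y) {f : Y → ℝ} {τ s : ℝ} (hτ : 0 < τ)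
    (hf : ∀ y, |f y| ≤ τ) (hs : 0 ≤ s) {n : ℕ} (hn : 0 < n) :
    ∑ x, prodW (Fin n) p x * (if s < |(∑ i, f (x i)) / n - ∑ y, p y * f y| then 1 else 0) ≤
      2 * Real.exp (-(n * s ^ 2 / (8 * τ ^ 2))) := by
  have hP := prodW_mem_stdSimplex (ι := Fin n) hp
  have hnR : (0 : ℝ) < n := by exact_mod_cast hn
  obtain ⟨μ, hμ⟩ : ∃ μ, μ = ∑ y, p y * f y := ⟨_, rfl⟩
  have hμτ : |μ| ≤ τ := by
    rw [hμ]
    calc |∑ y, p y * f y| ≤ ∑ y, |p y * f y| := abs_sum_le_sum_abs _ _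
      _ ≤ ∑ y, p y * τ := sum_le_sum fun y _ => by
        rw [abs_mul, abs_of_nonneg (hp.1 y)]
        exact mul_le_mul_of_nonneg_left (hf y) (hp.1 y)
      _ = τ := by rw [← sum_mul, hp.2, one_mul]
  have hg : ∀ y, |f y - μ| ≤ 2 * τ := fun y =>
    (abs_sub _ _).trans (by linarith [hf y])
  have hg0 : ∑ y, p y * (f y - μ) = 0 := by
    simp only [mul_sub, sum_sub_distrib, ← sum_mul, hp.2, ← hμ]
    ring
  rw [← hμ]
  -- This minimizes -tns + n(2τt)²/2; centring costs the bound 2τ instead of τ.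
  obtain ⟨t, ht⟩ : ∃ t, t = s / (2 * τ) ^ 2 := ⟨_, rfl⟩
  have ht0 : 0 ≤ t := ht ▸ by positivity
  have h1 := mgf_prodW_le (ι := Fin n) hp (by positivity) hg hg0 t
  have h2 := mgf_prodW_le (ι := Fin n) hp (by positivity) hg hg0 (-t)
  rw [Fintype.card_fin] at h1 h2
  have hpt : ∀ x : Fin n → Y, (if s < |(∑ i, f (x i)) / n - μ| then (1 : ℝ) else 0) ≤
      Real.exp (-(t * (n * s))) * (Real.exp (t * ∑ i, (f (x i) - μ)) +
        Real.exp (-t * ∑ i, (f (x i) - μ))) := fun x => by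
    split_ifs with h
    · have e1 : ∑ i, (f (x i) - μ) = n * ((∑ i, f (x i)) / n - μ) := by
        rw [sum_sub_distrib]
        simp
        field_simp
      rw [e1, mul_add, ← Real.exp_add, ← Real.exp_add]
      rcases lt_abs.1 h with h | h
      · refine le_add_of_le_of_nonneg (Real.one_le_exp ?_) (Real.exp_pos _).le
        have := mul_le_mul_of_nonneg_left (mul_le_mul_of_nonneg_left h.le hnR.le) ht0
        linarith
      · refine le_add_of_nonneg_of_le (Real.exp_pos _).le (Real.one_le_exp ?_)
        have := mul_le_mul_of_nonneg_left (mul_le_mul_of_nonneg_left h.le hnR.le) ht0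
        linarith
    · positivity
  calc _ ≤ ∑ x, prodW (Fin n) p x * (Real.exp (-(t * (n * s))) *
        (Real.exp (t * ∑ i, (f (x i) - μ)) + Real.exp (-t * ∑ i, (f (x i) - μ)))) :=
        sum_le_sum fun x _ => mul_le_mul_of_nonneg_left (hpt x) (hP.1 x)
    _ = Real.exp (-(t * (n * s))) *
        (∑ x, prodW (Fin n) p x * Real.exp (t * ∑ i, (f (x i) - μ)) +
          ∑ x, prodW (Fin n) p x * Real.exp (-t * ∑ i, (f (x i) - μ))) := by
        rw [← sum_add_distrib, mul_sum]
        exact sum_congr rfl fun x _ => by ring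
    _ ≤ Real.exp (-(t * (n * s))) * (Real.exp (n * ((t * (2 * τ)) ^ 2 / 2)) +
          Real.exp (n * ((-t * (2 * τ)) ^ 2 / 2))) :=
        mul_le_mul_of_nonneg_left (add_le_add h1 h2) (Real.exp_pos _).le
    _ = 2 * Real.exp (-(n * s ^ 2 / (8 * τ ^ 2))) := by
        rw [show (-t * (2 * τ)) ^ 2 = (t * (2 * τ)) ^ 2 by ring, ← two_mul, mul_left_comm,
          ← Real.exp_add, ht]
        congr 2
        field_simp
        ring

end Concentration

/-! ### Bias of the truncated empirical masses. -/

section Clipping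

/-- Truncation to the interval `[-τ, τ]`. -/
def clip (τ u : ℝ) : ℝ := max (-τ) (min u τ)

lemma abs_clip_le {τ : ℝ} (hτ : 0 ≤ τ) (u : ℝ) : |clip τ u| ≤ τ :=
  abs_le.2 ⟨le_max_left _ _, max_le (by linarith) (min_le_right _ _)⟩

/-- Here `v` is mean-zero noise and `η` a bound on the bias. Truncation raises the value only at -τ,
where the excess of |v| over `a` pays for it; `le_clip` is the mirror image at τ. -/
lemma clip_le {τ a η u v : ℝ} (hu : u ≤ v + η) (ha : a ≤ τ + η) :
    clip τ u ≤ v + η + max (|v| - a) 0 := by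
  have h0 := le_max_right (|v| - a) 0
  have h1 := le_max_left (|v| - a) 0
  refine max_le ?_ ((min_le_left _ _).trans (by linarith))
  linarith [neg_abs_le v]

lemma le_clip {τ a η u v : ℝ} (hu : v + η ≤ u) (ha : a ≤ τ - η) :
    v + η - max (|v| - a) 0 ≤ clip τ u := by
  have h0 := le_max_right (|v| - a) 0
  have h1 := le_max_left (|v| - a) 0
  refine le_max_of_le_right (le_min (by linarith) ?_)
  linarith [le_abs_self v]

variable {k m : ℕ}

/-- The indicator of a set of points. -/
def ind (W : Finset (Fin k)) (z : Fin k) : ℝ := if z ∈ W then 1 else 0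

/-- The mass of a set of points. -/
def mass (q : Fin k → ℝ) (W : Finset (Fin k)) : ℝ := ∑ z, q z * ind W z

/-- The fraction of the samples of a user that lie in a set. -/
def emp (W : Finset (Fin k)) (y : Fin m → Fin k) : ℝ := (∑ j, ind W (y j)) / m

lemma ind_nonneg (W : Finset (Fin k)) (z : Fin k) : 0 ≤ ind W z := by
  rw [ind]; split_ifs <;> norm_num

lemma ind_le_one (W : Finset (Fin k)) (z : Fin k) : ind W z ≤ 1 := by
  rw [ind]; split_ifs <;> norm_num

lemma mass_nonneg {q : Fin k → ℝ} (hq : q ∈ stdSimplex ℝ (Fin k)) (W : Finset (Fin k)) :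
    0 ≤ mass q W := sum_nonneg fun z _ => mul_nonneg (hq.1 z) (ind_nonneg W z)

lemma mass_le_one {q : Fin k → ℝ} (hq : q ∈ stdSimplex ℝ (Fin k)) (W : Finset (Fin k)) :
    mass q W ≤ 1 := by
  rw [← hq.2]
  exact sum_le_sum fun z _ => mul_le_of_le_one_right (hq.1 z) (ind_le_one W z)

lemma mass_sub_mass_le {p q : Fin k → ℝ} (hp : p ∈ stdSimplex ℝ (Fin k))
    (hq : q ∈ stdSimplex ℝ (Fin k)) (W : Finset (Fin k)) : mass p W - mass q W ≤ tvW p q := by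
  have := sum_mul_sub_sum_mul_le hp hq (ind_nonneg W) (ind_le_one W)
  simpa [mass] using this

lemma exists_mass_sub_mass_eq {p q : Fin k → ℝ} (hp : p ∈ stdSimplex ℝ (Fin k))
    (hq : q ∈ stdSimplex ℝ (Fin k)) : ∃ W, mass p W - mass q W = tvW p q := by
  refine ⟨univ.filter fun z => q z ≤ p z, ?_⟩
  have h : ∀ z, (p z - q z) * ind (univ.filter fun z => q z ≤ p z) z =
      (1 / 2) * |p z - q z| + (1 / 2) * (p z - q z) := fun z => by
    by_cases hz : q z ≤ p z
    · rw [abs_of_nonneg (by linarith)]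
      simp [ind, hz]
      ring
    · rw [abs_of_neg (by linarith)]
      simp [ind, hz]
      ring
  rw [mass, mass, ← sum_sub_distrib]
  simp only [← sub_mul, h]
  rw [sum_add_distrib, ← mul_sum, ← mul_sum, sum_sub_distrib, hp.2, hq.2, sub_self, mul_zero,
    add_zero, tvW]

lemma emp_mgf_le {p : Fin k → ℝ} (hp : p ∈ stdSimplex ℝ (Fin k)) (hm : 0 < m)
    (W : Finset (Fin k)) (t : ℝ) :
    ∑ y, prodW (Fin m) p y * Real.exp (t * (emp W y - mass p W)) ≤ Real.exp (t ^ 2 / (2 * m)) := by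
  have hmR : (0 : ℝ) < m := by exact_mod_cast hm
  have h := mgf_prodW_le (ι := Fin m) hp (f := fun z => ind W z - mass p W) one_pos (fun z => by
    rw [abs_le]
    constructor <;>
      linarith [ind_nonneg W z, ind_le_one W z, mass_nonneg hp W, mass_le_one hp W])
    (by
      simp only [mul_sub, sum_sub_distrib, ← sum_mul, hp.2, one_mul]
      exact sub_self _) (t / m)
  have e1 : ∀ y : Fin m → Fin k,
      t / m * ∑ j, (ind W (y j) - mass p W) = t * (emp W y - mass p W) := fun y => by
    rw [sum_sub_distrib, emp]
    simp
    field_simp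
  have e2 : ((Fintype.card (Fin m) : ℕ) : ℝ) * ((t / m * 1) ^ 2 / 2) = t ^ 2 / (2 * m) := by
    rw [Fintype.card_fin]
    field_simp
  simp only [e1] at h
  rwa [e2] at h

lemma emp_mean {p : Fin k → ℝ} (hp : p ∈ stdSimplex ℝ (Fin k)) (hm : 0 < m)
    (W : Finset (Fin k)) : ∑ y, prodW (Fin m) p y * (emp W y - mass p W) = 0 := by
  have hmR : (0 : ℝ) < m := by exact_mod_cast hm
  have hP := prodW_mem_stdSimplex (ι := Fin m) hp
  have h1 : ∀ j : Fin m, ∑ y : Fin m → Fin k, prodW (Fin m) p y * ind W (y j) = mass p W := by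
    intro j
    have e : ∀ y : Fin m → Fin k, prodW (Fin m) p y * ind W (y j) =
        ∏ i, p (y i) * if i = j then ind W (y i) else 1 := fun y => by
      rw [prod_mul_distrib, prod_ite_eq' univ j fun i => ind W (y i), if_pos (mem_univ j), prodW]
    simp only [e]
    rw [sum_prod_apply fun i z => p z * if i = j then ind W z else 1, prod_eq_single j]
    · simp [mass]
    · intro i _ hi
      simp [hi, hp.2]
    · simp
  simp only [mul_sub, sum_sub_distrib, ← sum_mul, hP.2, one_mul, emp, mul_div_assoc', mul_sum,
    ← sum_div]
  rw [sum_comm]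
  simp [h1]
  field_simp
  simp

/-- The noise is subgaussian at scale 1/√m, so exponential moments at ±√m are at most e^{1/2} ≤ 2;
the excess is dominated by e^{-L} times their sum. -/
lemma emp_excess_le {p : Fin k → ℝ} (hp : p ∈ stdSimplex ℝ (Fin k)) (hm : 0 < m)
    (W : Finset (Fin k)) (L : ℝ) :
    ∑ y, prodW (Fin m) p y * max (|emp W y - mass p W| - L / √(m : ℝ)) 0 ≤ 4 * Real.exp (-L) := by
  have hmR : (1 : ℝ) ≤ m := by exact_mod_cast hm
  have hP := prodW_mem_stdSimplex (ι := Fin m) hp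
  obtain ⟨r, hr⟩ : ∃ r, r = √(m : ℝ) := ⟨_, rfl⟩
  have hr1 : 1 ≤ r := hr ▸ Real.one_le_sqrt.2 hmR
  have hrm : r ^ 2 = m := by rw [hr, Real.sq_sqrt (by linarith)]
  rw [← hr]
  have h1 := emp_mgf_le hp hm W r
  have h2 := emp_mgf_le hp hm W (-r)
  have e : r ^ 2 / (2 * (m : ℝ)) = 1 / 2 := by
    rw [hrm]
    field_simp
  rw [neg_sq, e] at h2
  rw [e] at h1
  have hpt : ∀ v, max (|v| - L / r) 0 ≤
      Real.exp (-L) * (Real.exp (r * v) + Real.exp (-r * v)) := fun v => by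
    refine max_le ?_ (by positivity)
    have hx := Real.add_one_le_exp (r * (|v| - L / r))
    have h3 : r * (|v| - L / r) = -L + r * |v| := by
      field_simp
      ring
    have h4 : Real.exp (r * |v|) ≤ Real.exp (r * v) + Real.exp (-r * v) := by
      rcases abs_cases v with ⟨h, _⟩ | ⟨h, _⟩ <;> rw [h]
      · linarith [Real.exp_pos (-r * v)]
      · rw [mul_neg, ← neg_mul]
        linarith [Real.exp_pos (r * v)]
    by_cases h0 : |v| - L / r ≤ 0
    · exact h0.trans (by positivity)
    · push Not at h0
      calc |v| - L / r ≤ r * (|v| - L / r) := le_mul_of_one_le_left h0.le hr1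
        _ ≤ Real.exp (r * (|v| - L / r)) := by linarith
        _ = Real.exp (-L) * Real.exp (r * |v|) := by rw [h3, Real.exp_add]
        _ ≤ _ := mul_le_mul_of_nonneg_left h4 (Real.exp_pos _).le
  have h5 : Real.exp (1 / 2) ≤ 2 := by
    have : Real.exp (1 / 2) ^ 2 ≤ 2 ^ 2 := by
      rw [← Real.exp_nat_mul]
      have := Real.exp_one_lt_d9
      norm_num at this ⊢
      linarith
    exact le_of_sq_le_sq this (by norm_num)
  calc _ ≤ ∑ y, prodW (Fin m) p y * (Real.exp (-L) * (Real.exp (r * (emp W y - mass p W)) +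
        Real.exp (-r * (emp W y - mass p W)))) :=
        sum_le_sum fun y _ => mul_le_mul_of_nonneg_left (hpt _) (hP.1 y)
    _ = Real.exp (-L) * (∑ y, prodW (Fin m) p y * Real.exp (r * (emp W y - mass p W)) +
        ∑ y, prodW (Fin m) p y * Real.exp (-r * (emp W y - mass p W))) := by
        rw [← sum_add_distrib, mul_sum]
        exact sum_congr rfl fun y _ => by ring
    _ ≤ Real.exp (-L) * (2 + 2) :=
        mul_le_mul_of_nonneg_left (add_le_add (h1.trans h5) (h2.trans h5)) (Real.exp_pos _).le
    _ = _ := by ring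

lemma clip_mean_le {p : Fin k → ℝ} (hp : p ∈ stdSimplex ℝ (Fin k)) (hm : 0 < m)
    (W : Finset (Fin k)) {L τ η c : ℝ} (hc : mass p W - c ≤ η) (hL : L / √(m : ℝ) ≤ τ + η) :
    ∑ y, prodW (Fin m) p y * clip τ (emp W y - c) ≤ η + 4 * Real.exp (-L) := by
  have hP := prodW_mem_stdSimplex (ι := Fin m) hp
  calc _ ≤ ∑ y, prodW (Fin m) p y * (emp W y - mass p W + η +
        max (|emp W y - mass p W| - L / √(m : ℝ)) 0) :=
        sum_le_sum fun y _ => mul_le_mul_of_nonneg_left (clip_le (by linarith) hL) (hP.1 y)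
    _ = ∑ y, prodW (Fin m) p y * (emp W y - mass p W) + (∑ y, prodW (Fin m) p y) * η +
        ∑ y, prodW (Fin m) p y * max (|emp W y - mass p W| - L / √(m : ℝ)) 0 := by
        simp only [mul_add, sum_add_distrib, sum_mul]
    _ ≤ _ := by
        rw [emp_mean hp hm, hP.2]
        linarith [emp_excess_le hp hm W L]

lemma le_clip_mean {p : Fin k → ℝ} (hp : p ∈ stdSimplex ℝ (Fin k)) (hm : 0 < m)
    (W : Finset (Fin k)) {L τ η c : ℝ} (hc : η ≤ mass p W - c) (hL : L / √(m : ℝ) ≤ τ - η) :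
    η - 4 * Real.exp (-L) ≤ ∑ y, prodW (Fin m) p y * clip τ (emp W y - c) := by
  have hP := prodW_mem_stdSimplex (ι := Fin m) hp
  calc η - 4 * Real.exp (-L) ≤ ∑ y, prodW (Fin m) p y * (emp W y - mass p W) +
        (∑ y, prodW (Fin m) p y) * η -
        ∑ y, prodW (Fin m) p y * max (|emp W y - mass p W| - L / √(m : ℝ)) 0 := by
        rw [emp_mean hp hm, hP.2]
        linarith [emp_excess_le hp hm W L]
    _ = ∑ y, prodW (Fin m) p y * (emp W y - mass p W + η -
        max (|emp W y - mass p W| - L / √(m : ℝ)) 0) := by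
        simp only [mul_sub, mul_add, sum_add_distrib, sum_sub_distrib, sum_mul]
    _ ≤ _ := sum_le_sum fun y _ => mul_le_mul_of_nonneg_left (le_clip (by linarith) hL) (hP.1 y)

end Clipping

/-! ### The exponential mechanism. -/

section ExponentialMechanism

variable {I : Type*} [Fintype I] [Nonempty I]

/-- The weights of the exponential mechanism that favours small scores `s`. -/
def expW (κ : ℝ) (s : I → ℝ) (a : I) : ℝ := Real.exp (-κ * s a) / ∑ b, Real.exp (-κ * s b)

lemma sum_exp_pos (κ : ℝ) (s : I → ℝ) : 0 < ∑ b, Real.exp (-κ * s b) :=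
  sum_pos (fun _ _ => Real.exp_pos _) univ_nonempty

lemma expW_mem_stdSimplex (κ : ℝ) (s : I → ℝ) : expW κ s ∈ stdSimplex ℝ I := by
  refine ⟨fun a => (div_pos (Real.exp_pos _) (sum_exp_pos κ s)).le, ?_⟩
  simp only [expW]
  rw [← sum_div, div_self (sum_exp_pos κ s).ne']

/-- The numerator and the normalizer each cost a factor e^{κΔ}. -/
lemma expW_le {κ Δ : ℝ} (hκ : 0 ≤ κ) {s s' : I → ℝ} (h : ∀ a, s a ≤ s' a + Δ)
    (h' : ∀ a, s' a ≤ s a + Δ) (a : I) : expW κ s a ≤ Real.exp (κ * (2 * Δ)) * expW κ s' a := by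
  have h1 : Real.exp (-κ * s a) ≤ Real.exp (κ * Δ) * Real.exp (-κ * s' a) := by
    rw [← Real.exp_add]
    exact Real.exp_le_exp.2 (by nlinarith [h' a])
  have h2 : ∑ b, Real.exp (-κ * s' b) ≤ Real.exp (κ * Δ) * ∑ b, Real.exp (-κ * s b) := by
    rw [mul_sum]
    refine sum_le_sum fun b _ => ?_
    rw [← Real.exp_add]
    exact Real.exp_le_exp.2 (by nlinarith [h b])
  have hs := sum_exp_pos κ s
  have hs' := sum_exp_pos κ s'
  rw [expW, expW, mul_div_assoc', div_le_div_iff₀ hs hs',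
    show κ * (2 * Δ) = κ * Δ + κ * Δ by ring, Real.exp_add]
  calc _ ≤ (Real.exp (κ * Δ) * Real.exp (-κ * s' a)) *
        (Real.exp (κ * Δ) * ∑ b, Real.exp (-κ * s b)) :=
        mul_le_mul h1 h2 hs'.le (by positivity)
    _ = _ := by ring

lemma sum_expW_le {κ t : ℝ} (hκ : 0 ≤ κ) {s : I → ℝ} (a₀ : I) {B : Finset I}
    (hB : ∀ a ∈ B, s a₀ + t ≤ s a) : ∑ a ∈ B, expW κ s a ≤ Fintype.card I * Real.exp (-(κ * t)) := by
  have h1 : ∀ a ∈ B, expW κ s a ≤ Real.exp (-(κ * t)) := fun a ha => by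
    rw [expW, div_le_iff₀ (sum_exp_pos κ s)]
    calc Real.exp (-κ * s a) ≤ Real.exp (-(κ * t)) * Real.exp (-κ * s a₀) := by
          rw [← Real.exp_add]
          exact Real.exp_le_exp.2 (by nlinarith [hB a ha])
      _ ≤ _ := mul_le_mul_of_nonneg_left
        (single_le_sum (f := fun b => Real.exp (-κ * s b)) (fun b _ => (Real.exp_pos _).le)
          (mem_univ a₀)) (Real.exp_pos _).le
  calc ∑ a ∈ B, expW κ s a ≤ ∑ a ∈ B, Real.exp (-(κ * t)) := sum_le_sum h1
    _ ≤ ∑ _a : I, Real.exp (-(κ * t)) := sum_le_univ_sum_of_nonneg fun _ => (Real.exp_pos _).le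
    _ = _ := by simp

end ExponentialMechanism

/-! ### A finite cover of the simplex. -/

section Cover

variable {k : ℕ}

/-- A grid of distributions on `k` points. -/
def gridW (N : ℕ) (a : Fin k → Fin (N + 1)) (z : Fin k) : ℝ :=
  ((a z : ℕ) + 1) / ∑ z', (((a z' : ℕ) : ℝ) + 1)

lemma gridW_mem_stdSimplex (hk : 0 < k) (N : ℕ) (a : Fin k → Fin (N + 1)) :
    gridW N a ∈ stdSimplex ℝ (Fin k) := by
  have : Nonempty (Fin k) := ⟨⟨0, hk⟩⟩
  have h : 0 < ∑ z', (((a z' : ℕ) : ℝ) + 1) := sum_pos (fun _ _ => by positivity) univ_nonempty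
  refine ⟨fun z => by rw [gridW]; positivity, ?_⟩
  simp only [gridW]
  rw [← sum_div, div_self h.ne']

lemma exists_tvW_gridW_le {p : Fin k → ℝ} (hp : p ∈ stdSimplex ℝ (Fin k)) {N : ℕ} (hN : 0 < N) :
    ∃ a : Fin k → Fin (N + 1), tvW p (gridW N a) ≤ k / N := by
  have hNR : (0 : ℝ) < N := by exact_mod_cast hN
  have hp1 : ∀ z, p z ≤ 1 := fun z => by
    rw [← hp.2]
    exact single_le_sum (fun z _ => hp.1 z) (mem_univ z)
  have hfl : ∀ z, ⌊N * p z⌋₊ < N + 1 := fun z => by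
    rw [Nat.lt_succ_iff]
    exact Nat.floor_le_of_le (mul_le_of_le_one_right hNR.le (hp1 z))
  -- With the added ones in `gridW`, the normalizer lies between N and N + k, so rounding and
  -- normalization each cost k/N in ℓ¹.
  refine ⟨fun z => ⟨⌊N * p z⌋₊, hfl z⟩, ?_⟩
  have hlo : ∀ z, N * p z ≤ (⌊N * p z⌋₊ : ℝ) + 1 := fun z => (Nat.lt_floor_add_one _).le
  have hup : ∀ z, (⌊N * p z⌋₊ : ℝ) + 1 ≤ N * p z + 1 := fun z =>
    add_le_add_left (Nat.floor_le (mul_nonneg hNR.le (hp.1 z))) 1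
  obtain ⟨S, hS⟩ : ∃ S, S = ∑ z, ((⌊N * p z⌋₊ : ℝ) + 1) := ⟨_, rfl⟩
  have hS1 : (N : ℝ) ≤ S := by
    calc (N : ℝ) = ∑ z, N * p z := by rw [← mul_sum, hp.2, mul_one]
      _ ≤ S := hS ▸ sum_le_sum fun z _ => hlo z
  have hS2 : S ≤ N + k := by
    calc S ≤ ∑ z, (N * p z + 1) := hS ▸ sum_le_sum fun z _ => hup z
      _ = N + k := by
        rw [sum_add_distrib, ← mul_sum, hp.2]
        simp
  have hS0 : 0 < S := hNR.trans_le hS1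
  have hpt : ∀ z, |p z - ((⌊N * p z⌋₊ : ℝ) + 1) / S| ≤ 1 / N + p z * (k / N) := fun z => by
    have h1 : ((⌊N * p z⌋₊ : ℝ) + 1) / S ≤ p z + 1 / N := by
      calc ((⌊N * p z⌋₊ : ℝ) + 1) / S ≤ (N * p z + 1) / N :=
            div_le_div₀ (add_nonneg (mul_nonneg hNR.le (hp.1 z)) zero_le_one) (hup z) hNR hS1
        _ = p z + 1 / N := by field_simp
    have h2 : p z - p z * (k / N) ≤ ((⌊N * p z⌋₊ : ℝ) + 1) / S := by
      rw [le_div_iff₀ hS0]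
      refine le_trans ?_ (hlo z)
      have h3 : (1 - k / N) * S ≤ N := by
        by_cases hneg : (1 - (k : ℝ) / N) ≤ 0
        · nlinarith
        · push Not at hneg
          calc (1 - (k : ℝ) / N) * S ≤ (1 - k / N) * (N + k) :=
                mul_le_mul_of_nonneg_left hS2 hneg.le
            _ = N - k ^ 2 / N := by
                field_simp
                ring
            _ ≤ N := sub_le_self _ (by positivity)
      calc (p z - p z * (k / N)) * S = p z * ((1 - k / N) * S) := by ring
        _ ≤ p z * N := mul_le_mul_of_nonneg_left h3 (hp.1 z)
        _ = _ := mul_comm _ _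
    have h4 : 0 ≤ p z * (k / N) := mul_nonneg (hp.1 z) (by positivity)
    have h5 : (0 : ℝ) ≤ 1 / N := by positivity
    rw [abs_le]
    constructor <;> linarith
  have hsum : ∑ z, |p z - ((⌊N * p z⌋₊ : ℝ) + 1) / S| ≤ 2 * (k / N) := by
    calc _ ≤ ∑ z, (1 / N + p z * (k / N)) := sum_le_sum fun z _ => hpt z
      _ = 2 * (k / N) := by
        rw [sum_add_distrib, ← sum_mul, hp.2]
        simp
        field_simp
        ring
  simp only [tvW, gridW, ← hS]
  linarith

end Cover

/-! ### Scores, private selection and its accuracy. -/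

section Score

variable {k m n : ℕ}

/-- The empirical mean over the users of the clipped deviations from the mass `q W`. -/
def avg (τ : ℝ) (q : Fin k → ℝ) (W : Finset (Fin k)) (x : Input (Fin k) n m) : ℝ :=
  (∑ i, clip τ (emp W (x i) - mass q W)) / n

/-- The score of a candidate distribution: the largest clipped deviation over all sets. -/
def score (τ : ℝ) (q : Fin k → ℝ) (x : Input (Fin k) n m) : ℝ :=
  univ.sup' univ_nonempty fun W => avg τ q W x

lemma avg_le_score (τ : ℝ) (q : Fin k → ℝ) (W : Finset (Fin k)) (x : Input (Fin k) n m) :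
    avg τ q W x ≤ score τ q x := le_sup' (fun W => avg τ q W x) (mem_univ W)

lemma score_le_of_neighbors {τ : ℝ} (hτ : 0 ≤ τ) (q : Fin k → ℝ) {x x' : Input (Fin k) n m}
    (h : Neighbors x x') : score τ q x ≤ score τ q x' + 2 * τ / n := by
  refine sup'_le _ _ fun W _ => le_trans ?_ (add_le_add_left (avg_le_score τ q W x') _)
  obtain ⟨i, hi⟩ := h
  rw [avg, avg, ← add_div]
  refine div_le_div_of_nonneg_right ?_ (Nat.cast_nonneg n)
  rw [← sub_le_iff_le_add', ← sum_sub_distrib, sum_eq_single i]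
  · have h1 := abs_le.1 (abs_clip_le hτ (emp W (x i) - mass q W))
    have h2 := abs_le.1 (abs_clip_le hτ (emp W (x' i) - mass q W))
    linarith
  · intro j _ hj
    rw [hi j hj, sub_self]
  · simp

lemma neighbors_symm {Z : Type*} {x x' : Input Z n m} (h : Neighbors x x') : Neighbors x' x := by
  obtain ⟨i, hi⟩ := h
  exact ⟨i, fun j hj => (hi j hj).symm⟩

variable {I : Type*} [Fintype I] [Nonempty I]

/-- The private selection algorithm over a finite family of candidate distributions. -/
def selectAlg (κ τ : ℝ) (hyp : I → Fin k → ℝ) (hh : ∀ a, hyp a ∈ stdSimplex ℝ (Fin k)) :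
    RandAlg (Fin k) (PMF (Fin k)) n m := fun x =>
  (ofSimplex (expW κ fun a => score τ (hyp a) x) (expW_mem_stdSimplex _ _)).map
    fun a => ofSimplex (hyp a) (hh a)

lemma finiteOutput_selectAlg (κ τ : ℝ) (hyp : I → Fin k → ℝ)
    (hh : ∀ a, hyp a ∈ stdSimplex ℝ (Fin k)) :
    FiniteOutput (selectAlg κ τ hyp hh : RandAlg (Fin k) (PMF (Fin k)) n m) := by
  classical
  refine ⟨univ.image fun a => ofSimplex (hyp a) (hh a), fun x Q hQ => ?_⟩
  rw [selectAlg, PMF.mem_support_map_iff] at hQ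
  obtain ⟨a, _, rfl⟩ := hQ
  simp

lemma isUserLevelDP_selectAlg {ε κ τ : ℝ} (hκ : 0 ≤ κ) (hτ : 0 ≤ τ)
    (hε : κ * (2 * (2 * τ / n)) = ε) (hyp : I → Fin k → ℝ)
    (hh : ∀ a, hyp a ∈ stdSimplex ℝ (Fin k)) :
    IsUserLevelDP ε 0 (selectAlg κ τ hyp hh : RandAlg (Fin k) (PMF (Fin k)) n m) := by
  refine isUserLevelDP_map _ fun x x' h a => ?_
  rw [ofSimplex_apply, ofSimplex_apply, ← ENNReal.ofReal_mul (Real.exp_pos ε).le, ← hε]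
  exact ENNReal.ofReal_le_ofReal (expW_le hκ
    (fun b => score_le_of_neighbors hτ (hyp b) h)
    (fun b => score_le_of_neighbors hτ (hyp b) (neighbors_symm h)) a)

/-- Approximation, truncation and sampling each cost the good candidate α/8. A bad one has a set
where `p` exceeds `q` by at least α, and keeps α - 2α/8. The α in `τ` ensures that truncation does
not hide this. -/
lemma score_gap {p : Fin k → ℝ} (hp : p ∈ stdSimplex ℝ (Fin k)) (hm : 0 < m) {α L τ : ℝ}
    (hα : 0 < α) (hL : 4 * Real.exp (-L) ≤ α / 8) (hτ : τ = α + L / √(m : ℝ))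
    {q₀ q : Fin k → ℝ} (hq₀ : q₀ ∈ stdSimplex ℝ (Fin k)) (hq : q ∈ stdSimplex ℝ (Fin k))
    (h₀ : tvW p q₀ ≤ α / 8) (h : α ≤ tvW p q) {x : Input (Fin k) n m}
    (hx₀ : ∀ W, |avg τ q₀ W x - ∑ y, prodW (Fin m) p y * clip τ (emp W y - mass q₀ W)| ≤ α / 8)
    (hx : ∀ W, |avg τ q W x - ∑ y, prodW (Fin m) p y * clip τ (emp W y - mass q W)| ≤ α / 8) :
    score τ q₀ x + 3 * α / 8 ≤ score τ q x := by
  have h1 : score τ q₀ x ≤ 3 * α / 8 := sup'_le _ _ fun W _ => by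
    have h2 := clip_mean_le hp hm W (L := L) (τ := τ) (η := α / 8) (c := mass q₀ W)
      ((mass_sub_mass_le hp hq₀ W).trans h₀) (by linarith)
    linarith [(abs_le.1 (hx₀ W)).2]
  obtain ⟨W, hW⟩ := exists_mass_sub_mass_eq hp hq
  have h3 := le_clip_mean hp hm W (L := L) (τ := τ) (η := α) (c := mass q W)
    (by rw [hW]; exact h) (by linarith)
  linarith [(abs_le.1 (hx W)).1, avg_le_score τ q W x]

lemma isUseful_selectAlg (hm : 0 < m) (hn : 0 < n) {α L τ κ : ℝ} (hα : 0 < α) (hκ : 0 ≤ κ)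
    (hL0 : 0 ≤ L) (hL : 4 * Real.exp (-L) ≤ α / 8) (hτ : τ = α + L / √(m : ℝ))
    (hyp : I → Fin k → ℝ) (hh : ∀ a, hyp a ∈ stdSimplex ℝ (Fin k))
    (hcov : ∀ p ∈ stdSimplex ℝ (Fin k), ∃ a, tvW p (hyp a) ≤ α / 8)
    (h1 : Fintype.card I * Real.exp (-(κ * (3 * α / 8))) ≤ 1 / 6)
    (h2 : Fintype.card I * (2 ^ k * (2 * Real.exp (-(n * (α / 8) ^ 2 / (8 * τ ^ 2))))) ≤ 1 / 6) :
    IsUseful (discreteDistTask k α) (2 / 3)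
      (selectAlg κ τ hyp hh : RandAlg (Fin k) (PMF (Fin k)) n m) := by
  classical
  rw [isUseful_iff]
  intro D _
  obtain ⟨p, hpD⟩ : ∃ p, p = fun z => (D z).toReal := ⟨_, rfl⟩
  have hp : p ∈ stdSimplex ℝ (Fin k) := hpD ▸ toReal_mem_stdSimplex D
  rw [← hpD]
  have hP := prodW_mem_stdSimplex (ι := Fin m) hp
  have hPn := prodW_mem_stdSimplex (ι := Fin n) hP
  have hτ0 : 0 < τ := hτ ▸ add_pos_of_pos_of_nonneg hα (by positivity)
  obtain ⟨a₀, ha₀⟩ := hcov p hp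
  let dev : I → Finset (Fin k) → Input (Fin k) n m → ℝ := fun a W x =>
    |avg τ (hyp a) W x - ∑ y, prodW (Fin m) p y * clip τ (emp W y - mass (hyp a) W)|
  let bad : Input (Fin k) n m → ℝ := fun x => ∑ a, ∑ W, if α / 8 < dev a W x then 1 else 0
  have hbad : ∑ x, prodW (Fin n) (prodW (Fin m) p) x * bad x ≤ 1 / 6 := by
    calc ∑ x, prodW (Fin n) (prodW (Fin m) p) x * bad x
        = ∑ a : I, ∑ W : Finset (Fin k), ∑ x, prodW (Fin n) (prodW (Fin m) p) x *
            (if α / 8 < dev a W x then 1 else 0) := by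
          simp only [bad, mul_sum]
          rw [sum_comm]
          exact sum_congr rfl fun a _ => sum_comm
      _ ≤ ∑ a : I, ∑ W : Finset (Fin k),
            2 * Real.exp (-(n * (α / 8) ^ 2 / (8 * τ ^ 2))) :=
          sum_le_sum fun a _ => sum_le_sum fun W _ =>
            hoeffding hP (f := fun y => clip τ (emp W y - mass (hyp a) W)) hτ0
              (fun y => abs_clip_le hτ0.le _) (by positivity) hn
      _ ≤ 1 / 6 := by simpa using h2
  -- If all deviations are small, only the mechanism can fail, with probability at most 1/6;
  -- otherwise `bad x` is at least 1 and the left side is negative.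
  have hgood : ∀ x, 5 / 6 - bad x ≤
      prob (selectAlg κ τ hyp hh x) ((discreteDistTask k α).correct D) := fun x => by
    by_cases hx : ∀ a W, dev a W x ≤ α / 8
    · have hb : bad x = 0 := sum_eq_zero fun a _ => sum_eq_zero fun W _ => if_neg (not_lt.2 (hx a W))
      let S : Finset I := univ.filter fun a => tvW p (hyp a) ≤ α
      have hS : prob (selectAlg κ τ hyp hh x) ((discreteDistTask k α).correct D) =
          ∑ a ∈ S, expW κ (fun a => score τ (hyp a) x) a := by
        rw [selectAlg, prob_map]
        have : (fun a => ofSimplex (hyp a) (hh a)) ⁻¹' (discreteDistTask k α).correct D =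
            (S : Set I) := by
          ext a
          have h3 : ∀ z, (ofSimplex (hyp a) (hh a) z).toReal = hyp a z :=
            congr_fun (toReal_ofSimplex (hh a))
          simp only [Set.mem_preimage, discreteDistTask, Set.mem_ofPred_eq, tvDist, h3, S, tvW, hpD,
            coe_filter, mem_univ, true_and, abs_sub_comm]
        rw [this, prob_coe_finset]
        exact sum_congr rfl fun a _ => congr_fun (toReal_ofSimplex _) a
      have h4 : ∑ a ∈ univ.filter (fun a => ¬ tvW p (hyp a) ≤ α),
          expW κ (fun a => score τ (hyp a) x) a ≤ 1 / 6 :=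
        (sum_expW_le hκ a₀ fun a ha => score_gap hp hm hα hL hτ (hh a₀) (hh a) ha₀
          (not_le.1 (mem_filter_univ a |>.1 ha)).le (hx a₀) (hx a)).trans h1
      have h5 := sum_filter_add_sum_filter_not univ (fun a => tvW p (hyp a) ≤ α)
        (expW κ fun a => score τ (hyp a) x)
      rw [(expW_mem_stdSimplex κ fun a => score τ (hyp a) x).2] at h5
      rw [hS, hb]
      linarith
    · push Not at hx
      obtain ⟨a, W, haW⟩ := hx
      have hb : 1 ≤ bad x := by
        have h3 : ∀ a W, (0 : ℝ) ≤ if α / 8 < dev a W x then 1 else 0 := fun a W => by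
          split_ifs <;> norm_num
        calc (1 : ℝ) = if α / 8 < dev a W x then 1 else 0 := (if_pos haW).symm
          _ ≤ ∑ W, if α / 8 < dev a W x then 1 else 0 :=
              single_le_sum (f := fun W => if α / 8 < dev a W x then (1 : ℝ) else 0)
                (fun W _ => h3 a W) (mem_univ W)
          _ ≤ bad x := single_le_sum
              (f := fun a => ∑ W, if α / 8 < dev a W x then (1 : ℝ) else 0)
              (fun a _ => sum_nonneg fun W _ => h3 a W) (mem_univ a)
      linarith [prob_nonneg (selectAlg κ τ hyp hh x) ((discreteDistTask k α).correct D)]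
  calc (2 / 3 : ℝ) ≤ (∑ x, prodW (Fin n) (prodW (Fin m) p) x) * (5 / 6) -
        ∑ x, prodW (Fin n) (prodW (Fin m) p) x * bad x := by
        rw [hPn.2]
        linarith
    _ = ∑ x, prodW (Fin n) (prodW (Fin m) p) x * (5 / 6 - bad x) := by
        simp only [mul_sub, sum_sub_distrib, sum_mul]
    _ ≤ _ := sum_le_sum fun x _ => mul_le_mul_of_nonneg_left (hgood x) (hPn.1 x)

end Score

end

/-! ### Choice of parameters for the upper bound. -/

section UpperBound

variable {k m : ℕ} {α ε : ℝ}

lemma div_le_rate (hα : 0 < α) (hε : 0 < ε) : k / ε ≤ discreteDistRate k m α ε := by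
  have h1 : 0 ≤ k / (α * ε * √(m : ℝ)) := by positivity
  have h2 : 0 ≤ k / (α ^ 2 * m) := by positivity
  rw [discreteDistRate]
  linarith

lemma mul_le_rate_div (hα : 0 < α) (hε : 0 < ε) (hε' : ε ≤ 1 / 240) :
    240 * k / α ≤ discreteDistRate k m α ε / α := by
  refine div_le_div_of_nonneg_right ((?_ : _ ≤ (k : ℝ) / ε).trans (div_le_rate hα hε)) hα.le
  rw [le_div_iff₀ hε]
  nlinarith [(Nat.cast_nonneg k : (0 : ℝ) ≤ k)]

lemma one_le_log_rate (hk : 2 ≤ k) (hα : 0 < α) (hα' : α ≤ 1 / 256) (hε : 0 < ε)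
    (hε' : ε ≤ 1 / 240) : 1 ≤ Real.log (discreteDistRate k m α ε / α) := by
  have hkR : (2 : ℝ) ≤ k := by exact_mod_cast hk
  have h : 3 ≤ discreteDistRate k m α ε / α := by
    refine le_trans ?_ (mul_le_rate_div hα hε hε')
    rw [le_div_iff₀ hα]
    linarith
  rw [Real.le_log_iff_exp_le (by linarith)]
  linarith [Real.exp_one_lt_d9]

theorem exists_alg_of_rate_le {n : ℕ} (hk : 2 ≤ k) (hm : 1 ≤ m) (hα : 0 < α)
    (hα' : α ≤ 1 / 256) (hε : 0 < ε) (hε' : ε ≤ 1 / 240)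
    (hn : 1024 * discreteDistRate k m α ε *
      Real.log (discreteDistRate k m α ε / α) ^ 3 ≤ n) :
    ∃ A : RandAlg (Fin k) (PMF (Fin k)) n m,
      FiniteOutput A ∧ IsUserLevelDP ε 0 A ∧ IsUseful (discreteDistTask k α) (2 / 3) A := by
  have hl1 := one_le_log_rate (m := m) hk hα hα' hε hε'
  have hfα := mul_le_rate_div (k := k) (m := m) hα hε hε'
  have hkR : (2 : ℝ) ≤ k := by exact_mod_cast hk
  have hmR : (1 : ℝ) ≤ m := by exact_mod_cast hm
  obtain ⟨f, hf⟩ : ∃ f, f = discreteDistRate k m α ε := ⟨_, rfl⟩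
  rw [← hf] at hn hl1 hfα
  obtain ⟨l, hl⟩ : ∃ l, l = Real.log (f / α) := ⟨_, rfl⟩
  rw [← hl] at hn hl1
  have hf480 : 480 ≤ f := by
    rw [div_le_div_iff_of_pos_right hα] at hfα
    linarith
  have hexp : Real.exp l = f / α := by rw [hl, Real.exp_log (by positivity)]
  obtain ⟨r, hr⟩ : ∃ r, r = √(m : ℝ) := ⟨_, rfl⟩
  have hr1 : 1 ≤ r := hr ▸ Real.one_le_sqrt.2 hmR
  have hrm : r ^ 2 = m := by rw [hr, Real.sq_sqrt (by linarith)]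
  have hnR : (0 : ℝ) < n := lt_of_lt_of_le (by positivity) hn
  have hn0 : 0 < n := by exact_mod_cast hnR
  obtain ⟨τ, hτ⟩ : ∃ τ, τ = α + l / √(m : ℝ) := ⟨_, rfl⟩
  have hτ0 : 0 < τ := hτ ▸ by positivity
  have hτl : τ ≤ l * (α + 1 / r) := by
    rw [hτ, ← hr, mul_add, mul_one_div]
    linarith [mul_le_mul_of_nonneg_right hl1 hα.le]
  -- The selection exponent beats the log-cardinality; the first two terms of the rate are used
  -- here.
  have hX : k * l ≤ ε * n / (4 * τ) * (3 * α / 8) := by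
    have h1 : k * (α + 1 / r) ≤ ε * α * f := by
      have h2 : k * (α + 1 / r) = ε * α * (k / ε + k / (α * ε * r)) := by
        field_simp
      rw [h2]
      refine mul_le_mul_of_nonneg_left ?_ (by positivity)
      rw [hf, discreteDistRate, ← hr]
      linarith [(by positivity : 0 ≤ k / (α ^ 2 * m))]
    have h3 : l ^ 2 ≤ l ^ 3 := pow_le_pow_right₀ hl1 (by norm_num)
    rw [div_mul_eq_mul_div, le_div_iff₀ (by positivity)]
    calc k * l * (4 * τ) ≤ k * l * (4 * (l * (α + 1 / r))) := by gcongr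
      _ = 4 * l ^ 2 * (k * (α + 1 / r)) := by ring
      _ ≤ 4 * l ^ 3 * (ε * α * f) := by gcongr
      _ ≤ (1024 * f * l ^ 3) * ε * (3 * α / 8) := by
        have : 0 ≤ l ^ 3 * (ε * α * f) := by positivity
        linarith
      _ ≤ n * ε * (3 * α / 8) := by gcongr
      _ = _ := by ring
  -- The Hoeffding exponent; k/ε ≥ k and the third term are used. Of the three logarithms, two come
  -- from τ² and one from the union bound.
  have hY : k * l ≤ n * (α / 8) ^ 2 / (8 * τ ^ 2) := by
    have h1 : k * (α ^ 2 + 1 / m) ≤ α ^ 2 * f := by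
      have h2 : k * (α ^ 2 + 1 / (m : ℝ)) = α ^ 2 * (k + k / (α ^ 2 * m)) := by
        field_simp
      rw [h2]
      refine mul_le_mul_of_nonneg_left ?_ (by positivity)
      have h3 : (k : ℝ) ≤ k / ε := by
        rw [le_div_iff₀ hε]
        nlinarith
      rw [hf, discreteDistRate]
      linarith [(by positivity : 0 ≤ k / (α * ε * √(m : ℝ)))]
    have h2 : (α + 1 / r) ^ 2 ≤ 2 * (α ^ 2 + 1 / m) := by
      rw [← hrm, ← one_div_pow]
      exact add_sq_le
    rw [le_div_iff₀ (by positivity)]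
    calc k * l * (8 * τ ^ 2) ≤ k * l * (8 * (l * (α + 1 / r)) ^ 2) := by gcongr
      _ = 8 * k * l ^ 3 * (α + 1 / r) ^ 2 := by ring
      _ ≤ 8 * k * l ^ 3 * (2 * (α ^ 2 + 1 / m)) := by gcongr
      _ = 16 * l ^ 3 * (k * (α ^ 2 + 1 / m)) := by ring
      _ ≤ 16 * l ^ 3 * (α ^ 2 * f) := by gcongr
      _ = (1024 * f * l ^ 3) * (α / 8) ^ 2 := by ring
      _ ≤ _ := by gcongr
  obtain ⟨N, hN⟩ : ∃ N, N = ⌈8 * k / α⌉₊ := ⟨_, rfl⟩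
  have hN1 : 8 * k / α ≤ N := hN ▸ Nat.le_ceil _
  have hNR : (0 : ℝ) < N := lt_of_lt_of_le (by positivity) hN1
  have hN0 : 0 < N := by exact_mod_cast hNR
  have hN2 : (N : ℝ) + 1 ≤ 10 * k / α := by
    have h1 : (N : ℝ) < 8 * k / α + 1 := hN ▸ Nat.ceil_lt_add_one (by positivity)
    have h2 : 2 ≤ 2 * k / α := by
      rw [le_div_iff₀ hα]
      linarith
    have h3 : 10 * k / α = 8 * k / α + 2 * k / α := by ring
    linarith
  -- The 12 is the failure budget 1/6 times Hoeffding's factor 2. Per coordinate the bound is 10 · 2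
  -- · 12 = 240 times k/α, at most e^l because ε ≤ 1/240.
  have hcard : (Fintype.card (Fin k → Fin (N + 1)) : ℝ) * (2 ^ k * 12) ≤ Real.exp (k * l) := by
    rw [Real.exp_nat_mul, hexp]
    have h1 : (12 : ℝ) ≤ 12 ^ k := le_self_pow₀ (by norm_num) (by omega)
    calc (Fintype.card (Fin k → Fin (N + 1)) : ℝ) * (2 ^ k * 12)
        = ((N : ℝ) + 1) ^ k * (2 ^ k * 12) := by simp
      _ ≤ (10 * k / α) ^ k * (2 ^ k * 12 ^ k) := by gcongr
      _ = (240 * k / α) ^ k := by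
        rw [← mul_pow, ← mul_pow]
        ring
      _ ≤ _ := by gcongr
  have hone : ∀ {c t : ℝ}, c ≤ Real.exp (k * l) → k * l ≤ t → c * Real.exp (-t) ≤ 1 :=
    fun hc ht => by
      rw [Real.exp_neg, ← div_eq_mul_inv, div_le_one (Real.exp_pos _)]
      exact hc.trans (Real.exp_le_exp.2 ht)
  have hX1 := hone hcard hX
  have hY1 := hone hcard hY
  have hk0 : 0 < k := by omega
  have hκ : 0 ≤ ε * n / (4 * τ) := by positivity
  -- This κ solves κ · 2 · (2τ/n) = ε, the score having sensitivity 2τ/n.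
  refine ⟨selectAlg (ε * n / (4 * τ)) τ (gridW N) (gridW_mem_stdSimplex hk0 N),
    finiteOutput_selectAlg _ _ _ _, isUserLevelDP_selectAlg hκ hτ0.le (by field_simp; norm_num) _ _,
    isUseful_selectAlg hm hn0 hα hκ (by linarith) ?_ hτ _ _ (fun p hp => ?_) ?_ ?_⟩
  · rw [Real.exp_neg, hexp, inv_div, mul_div_assoc', div_le_div_iff₀ (by linarith) (by norm_num)]
    nlinarith
  · obtain ⟨a, ha⟩ := exists_tvW_gridW_le hp hN0
    refine ⟨a, ha.trans ?_⟩
    rw [div_le_iff₀ hα] at hN1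
    rw [div_le_iff₀ hNR]
    linarith
  · have h1 : (1 : ℝ) ≤ 2 ^ k := one_le_pow₀ (by norm_num)
    have h2 : (0 : ℝ) ≤ (Fintype.card (Fin k → Fin (N + 1)) : ℝ) *
      Real.exp (-(ε * n / (4 * τ) * (3 * α / 8))) := by positivity
    nlinarith
  · linarith

end UpperBound

/-! ### Attainment of the minimal number of users. -/

section Complexity

lemma userComplexity_eq_coe {Z O : Type*} [Fintype Z] {T : StatTask Z O} {m n₀ : ℕ} {ε δ γ : ℝ}
    (h : ∃ A : RandAlg Z O n₀ m, FiniteOutput A ∧ IsUserLevelDP ε δ A ∧ IsUseful T γ A) :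
    ∃ n ≤ n₀, userComplexity T m ε δ γ = n ∧
      ∃ A : RandAlg Z O n m, FiniteOutput A ∧ IsUserLevelDP ε δ A ∧ IsUseful T γ A := by
  classical
  let P : ℕ → Prop := fun n =>
    ∃ A : RandAlg Z O n m, FiniteOutput A ∧ IsUserLevelDP ε δ A ∧ IsUseful T γ A
  have hP : ∃ n, P n := ⟨n₀, h⟩
  refine ⟨Nat.find hP, Nat.find_min' hP h, le_antisymm ?_ ?_, Nat.find_spec hP⟩
  · exact iInf₂_le (Nat.find hP) (Nat.find_spec hP)
  · exact le_iInf₂ fun n hn => by exact_mod_cast Nat.find_min' hP hn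

end Complexity

end UserLevelDP

end

theorem theoremE6 :
    ∃ (α₀ ε₀ C : ℝ) (c : ℕ), 0 < α₀ ∧ 0 < ε₀ ∧ 0 < C ∧
      ∀ (k : ℕ), 2 ≤ k → ∀ (m : ℕ), 1 ≤ m →
      ∀ (α : ℝ), 0 < α → α ≤ α₀ → ∀ (ε : ℝ), 0 < ε → ε ≤ ε₀ →
        ∃ n : ℕ,
          UserLevelDP.userComplexity (UserLevelDP.discreteDistTask k α) m ε 0 (2 / 3) = n ∧
          UserLevelDP.discreteDistRate k m α ε /
              (C * Real.log (UserLevelDP.discreteDistRate k m α ε / α) ^ c) ≤ n ∧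
          (n : ℝ) ≤ C * UserLevelDP.discreteDistRate k m α ε *
              Real.log (UserLevelDP.discreteDistRate k m α ε / α) ^ c := by
  -- 1/256 keeps γ = 128α at most 1/2, 1/240 serves the union bound, and 2000000 exceeds the sum of
  -- the three lower-bound constants.
  refine ⟨1 / 256, 1 / 240, 2000000, 3, by norm_num, by norm_num, by norm_num, ?_⟩
  intro k hk m hm α hα hα' ε hε hε'
  have hl := UserLevelDP.one_le_log_rate (m := m) hk hα hα' hε hε'
  have hl3 := one_le_pow₀ (n := 3) hl
  have hkR : (2 : ℝ) ≤ k := by exact_mod_cast hk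
  have hf : 1 ≤ UserLevelDP.discreteDistRate k m α ε := by
    refine le_trans ?_ (UserLevelDP.div_le_rate hα hε)
    rw [le_div_iff₀ hε]
    linarith
  obtain ⟨n, hn, hc, A, -, hA, hU⟩ := UserLevelDP.userComplexity_eq_coe
    (UserLevelDP.exists_alg_of_rate_le hk hm hα hα' hε hε' (Nat.le_ceil _))
  refine ⟨n, hc, ?_, ?_⟩
  · rw [div_le_iff₀ (by positivity)]
    have h := UserLevelDP.rate_le_of_isUseful hk hm hα hα' hε (by linarith) hA hU
    nlinarith [(Nat.cast_nonneg n : (0 : ℝ) ≤ n)]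
  · have h1 : (n : ℝ) ≤ _ := Nat.cast_le.2 hn
    have h2 := Nat.ceil_lt_add_one (a := 1024 * UserLevelDP.discreteDistRate k m α ε *
      Real.log (UserLevelDP.discreteDistRate k m α ε / α) ^ 3) (by positivity)
    -- The +1 from the ceiling is absorbed because the rate and the logarithm are both at least one.
    have h3 := one_le_mul_of_one_le_of_one_le hf hl3
    linarith
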